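/- Let $A$ be a nonempty finite alphabet and let $\varphi\colon A^+\to A^+$ be an endomorphism of the free semigroup $A^+$ (a substitution). Suppose that: (0) $\varphi$ is weakly primitive: for some $n\ge 1$, all the words $\varphi^n(a)$ ($a\in A$) have length at least two and the same factors of length two. Let $L_\varphi\subseteq A^+$ be the language of the minimal subshift of $\varphi$, that is, the set of words that are factors of $\varphi^k(a)$ with $a\in A$ and $k$ arbitrarily large. Let $\overline\Omega_A\mathsf S$ be the free profinite semigroup on $A$ and let $J(\varphi)=\overline{L_\varphi}\setminus L_\varphi$, where the closure is taken in $\overline\Omega_A\mathsf S$; this is a regular $\mathcal J$-class of $\overline\Omega_A\mathsf S$, and $G(\varphi)$ denotes its Schützenberger group, that is, any maximal subgroup of $\overline\Omega_A\mathsf S$ contained in $J(\varphi)$. Suppose moreover that: (1) all the words $\varphi(a)$ ($a\in A$) start with the same letter and end with the same letter; (2) $\varphi$ is injective, and $C=\varphi(A)$ is of bounded delay with respect to the set $L$ of finite words that are factors of elements of $J(\varphi)$: there is an integer $N$ such that every equality of one of the forms $uc_1\cdots c_mv=c'_1\cdots c'_n$ or $uc_1\cdots c_m=c'_1\cdots c'_nv$,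 in which the two products belong to $L$, $c_i,c'_j\in C$, $u$ is a nonempty suffix of a word of $C$, $v$ is a nonempty prefix of a word of $C$, and $m+n>N$, is reducible. Here an equality $x_1\cdots x_p=y_1\cdots y_q$ with $x_i,y_j\in A^+$ is reducible if $x_r\cdots x_p=y_s\cdots y_q$ for some indices $1\le r\le p$, $1\le s\le q$ with $r+s>2$. Let $\overline\Omega_A\mathsf G$ be the free profinite group on $A$. The continuous endomorphisms of $\overline\Omega_A\mathsf S$ and of $\overline\Omega_A\mathsf G$ that are determined by $a\mapsto\varphi(a)$ ($a\in A$) are denoted by $\varphi$ and $\varphi_{\mathsf G}$, and $\psi^\omega$ denotes the idempotent power $\lim_n\psi^{n!}$ (pointwise limit) of such an endomorphism $\psi$. Then there is the profinite group presentation $$G(\varphi)=\langle A\mid \varphi_{\mathsf G}^\omega(a)=a\ (a\in A)\rangle .$$ That is, let $N_\varphi$ be the closed normal subgroup of $\overline\Omega_A\mathsf G$ generated by the elements $\varphi_{\mathsf G}^\omega(a)\,a^{-1}$ ($a\in A$). Then $J(\varphi)$ contains a maximal subgroup $H$ for which there is an isomorphism of topological groups $\overline\Omega_A\mathsf G/N_\varphi\to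 H$ that sends the class of $a$ to $\varphi^\omega(a)$ for all $a\in A$, and every maximal subgroup contained in $J(\varphi)$ is isomorphic, as a topological group, to $\overline\Omega_A\mathsf G/N_\varphi$. -/

import Mathlib

open Filter Topology

noncomputable section

/-! ## Words, substitutions and their languages -/

/-- The free semigroup `A⁺` is Mathlib's `FreeSemigroup A`; this is the underlying nonempty list. -/
def FreeSemigroup.toWord {A : Type*} (w : FreeSemigroup A) : List A := w.head :: w.tail

/-- The last letter of a word of `A⁺`. -/
def FreeSemigroup.last {A : Type*} (w : FreeSemigroup A) : A :=
  w.toWord.getLast (List.cons_ne_nil _ _)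

/-- A substitution over `A` is an endomorphism of the free semigroup `A⁺`. -/
abbrev Substitution (A : Type*) := FreeSemigroup A →ₙ* FreeSemigroup A

namespace Substitution

variable {A : Type*}

/-- The word `φᵏ(a)`. -/
def iter (φ : Substitution A) (k : ℕ) (a : A) : FreeSemigroup A := φ^[k] (FreeSemigroup.of a)

/-- `φ` is weakly primitive: for some `n ≥ 1`, all the words `φⁿ(a)` have length at least two and
the same factors of length two. -/
def WeaklyPrimitive (φ : Substitution A) : Prop :=
  ∃ n : ℕ, 0 < n ∧ (∀ a, 2 ≤ (φ.iter n a).length) ∧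
    ∀ a b x y : A, [x, y] <:+: (φ.iter n a).toWord ↔ [x, y] <:+: (φ.iter n b).toWord

/-- The language `L(X_φ)` of the subshift of `φ`: the words that are factors of `φᵏ(a)` for some
letter `a`, for arbitrarily large `k`. -/
def language (φ : Substitution A) : Set (FreeSemigroup A) :=
  {w | ∃ᶠ k in atTop, ∃ a : A, w.toWord <:+: (φ.iter k a).toWord}

end Substitution

/-- The product in the free monoid of a finite sequence of words. -/
def wordProd {A : Type*} (us : List (FreeSemigroup A)) : List A := us.flatMap FreeSemigroup.toWord

/-- The equality `u₁ ⋯ uₘ = v₁ ⋯ vₙ` is reducible: `uᵣ ⋯ uₘ = vₛ ⋯ vₙ` for some indices `r ≤ m`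
and `s ≤ n`, not both equal to `1`. (In the code the indices start at `0`.) -/
def ReducibleEq {A : Type*} (us vs : List (FreeSemigroup A)) : Prop :=
  ∃ r s : ℕ, r < us.length ∧ s < vs.length ∧ 0 < r + s ∧
    wordProd (us.drop r) = wordProd (vs.drop s)

/-- The set of words `C` is of bounded delay with respect to the language `L`: there is `N` such
that all equalities `u c₁ ⋯ cₘ v = c'₁ ⋯ c'ₙ` and `u c₁ ⋯ cₘ = c'₁ ⋯ c'ₙ v` are reducible whenever
the products are in `L`, all `cᵢ`, `c'ⱼ` are in `C`, `u` is a suffix of a word of `C`, `v` is a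
prefix of a word of `C`, and `m + n > N`. -/
def BoundedDelay {A : Type*} (C L : Set (FreeSemigroup A)) : Prop :=
  ∃ N : ℕ, ∀ (u v : FreeSemigroup A) (cs cs' : List (FreeSemigroup A)),
    (∀ c ∈ cs, c ∈ C) → (∀ c ∈ cs', c ∈ C) →
    (∃ w ∈ C, u.toWord <:+ w.toWord) → (∃ w ∈ C, v.toWord <+: w.toWord) →
    N < cs.length + cs'.length →
    (wordProd (u :: cs ++ [v]) = wordProd cs' →
      (∃ w ∈ L, w.toWord = wordProd cs') → ReducibleEq (u :: cs ++ [v]) cs') ∧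
    (wordProd (u :: cs) = wordProd (cs' ++ [v]) →
      (∃ w ∈ L, w.toWord = wordProd (u :: cs)) → ReducibleEq (u :: cs) (cs' ++ [v]))

/-- `φ` is an encoding (that is, it is injective) of bounded delay with respect to `L`. -/
def Substitution.IsEncodingOfBoundedDelay {A : Type*} (φ : Substitution A)
    (L : Set (FreeSemigroup A)) : Prop :=
  Function.Injective φ ∧ BoundedDelay (Set.range fun a => φ (FreeSemigroup.of a)) L

/-! ## The free profinite semigroup on a finite set -/

/-- The congruences of finite index on `A⁺`. -/
abbrev FiniteCon (A : Type*) := {c : Con (FreeSemigroup A) // Finite c.Quotient}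

/-- The finite quotients of `A⁺` are discrete. -/
instance FiniteCon.topQuotient {A : Type*} (c : FiniteCon A) : TopologicalSpace c.1.Quotient := ⊥

/-- The free profinite semigroup on the finite set `A`: the inverse limit of all finite quotients
of `A⁺`, as a subsemigroup of their product. A family `x` is compatible if, for `c ≤ d`, whenever
`x c` is the class of a word `w`, so is `x d`. -/
def freeProfiniteSemigroup (A : Type*) : Subsemigroup (∀ c : FiniteCon A, c.1.Quotient) where
  carrier := {x | ∀ c d : FiniteCon A, c.1 ≤ d.1 → ∀ w : FreeSemigroup A,
    x c = (w : c.1.Quotient) → x d = (w : d.1.Quotient)}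
  mul_mem' := by
    intro x y hx hy c d h w hw
    obtain ⟨u, hu⟩ := Quotient.exists_rep (x c)
    obtain ⟨v, hv⟩ := Quotient.exists_rep (y c)
    have h1 := hx c d h u hu.symm
    have h2 := hy c d h v hv.symm
    have h3 : ((u * v : FreeSemigroup A) : c.1.Quotient) = (w : c.1.Quotient) := by
      rw [← hw, Pi.mul_apply, ← hu, ← hv]; rfl
    rw [Pi.mul_apply, h1, h2, ← Con.coe_mul]
    exact (Con.eq _).2 (h ((Con.eq _).1 h3))

/-- The free profinite semigroup as a type. It carries the topology induced by the product. -/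
abbrev FreeProfiniteSemigroup (A : Type*) : Type _ := freeProfiniteSemigroup A

namespace FreeProfiniteSemigroup

variable {A : Type*}

/-- The canonical homomorphism from `A⁺` to the free profinite semigroup. -/
def ofWord (w : FreeSemigroup A) : FreeProfiniteSemigroup A :=
  ⟨fun c => (w : c.1.Quotient), fun _ _ h _ hv => (Con.eq _).2 (h ((Con.eq _).1 hv))⟩

/-- The pull-back of a congruence of finite index under a substitution. -/
def pullback (φ : Substitution A) (c : FiniteCon A) : FiniteCon A :=
  ⟨c.1.comap φ (map_mul φ), by
    have h : Finite (Quotient c.1.toSetoid) := c.2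
    refine Finite.of_injective
      (Quotient.map φ (fun _ _ h => h) : (c.1.comap φ (map_mul φ)).Quotient → c.1.Quotient) ?_
    intro x y
    induction x using Quotient.inductionOn with | _ x
    induction y using Quotient.inductionOn with | _ y
    intro h
    exact Quotient.sound ((Con.eq c.1).1 h : c.1 (φ x) (φ y))⟩

/-- The homomorphism between the finite quotients of `A⁺` that is induced by a substitution. -/
def quotientMap (φ : Substitution A) (c : FiniteCon A) :
    (pullback φ c).1.Quotient → c.1.Quotient :=
  Quotient.map φ (fun _ _ h => h)

/-- The unique continuous endomorphism of the free profinite semigroup that extends `φ`. -/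
def extend (φ : Substitution A) : FreeProfiniteSemigroup A →ₙ* FreeProfiniteSemigroup A where
  toFun x := ⟨fun c => quotientMap φ c (x.1 (pullback φ c)), by
    intro c d h w hw
    obtain ⟨u, hu⟩ := Quotient.exists_rep (x.1 (pullback φ c))
    have h1 := x.2 (pullback φ c) (pullback φ d) (fun {a b} hab => h hab) u hu.symm
    have h2 : ((φ u : FreeSemigroup A) : c.1.Quotient) = (w : c.1.Quotient) := by
      rw [← hw]
      change _ = quotientMap φ c (x.1 (pullback φ c))
      rw [← hu]; rfl
    have h3 : quotientMap φ d (x.1 (pullback φ d)) = ((φ u : FreeSemigroup A) : d.1.Quotient) := by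
      rw [h1]; rfl
    exact h3.trans ((Con.eq _).2 (h ((Con.eq _).1 h2)))⟩
  map_mul' x y := by
    apply Subtype.ext
    funext c
    change quotientMap φ c (x.1 (pullback φ c) * y.1 (pullback φ c)) =
      quotientMap φ c (x.1 (pullback φ c)) * quotientMap φ c (y.1 (pullback φ c))
    generalize x.1 (pullback φ c) = p
    generalize y.1 (pullback φ c) = q
    induction p using Quotient.inductionOn with | _ p
    induction q using Quotient.inductionOn with | _ q
    exact congrArg (fun t : FreeSemigroup A => (t : c.1.Quotient)) (map_mul φ p q)

theorem extend_ofWord (φ : Substitution A) (w : FreeSemigroup A) :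
    extend φ (ofWord w) = ofWord (φ w) := rfl

theorem continuous_extend (φ : Substitution A) : Continuous (extend φ) := by
  refine Continuous.subtype_mk (continuous_pi fun c => ?_) _
  have : DiscreteTopology (pullback φ c).1.Quotient := ⟨rfl⟩
  exact continuous_of_discreteTopology.comp
    ((continuous_apply (pullback φ c)).comp continuous_subtype_val)

end FreeProfiniteSemigroup

/-! ## The free profinite group on a finite set, and profinite presentations -/

/-- The free profinite group on the finite set `A`: the profinite completion of the free group. -/
def FreeProfiniteGroup (A : Type*) : ProfiniteGrp :=
  ProfiniteGrp.profiniteCompletion.obj (GrpCat.of (FreeGroup A))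

namespace FreeProfiniteGroup

variable {A : Type*}

/-- The free generators of the free profinite group. -/
def of (a : A) : FreeProfiniteGroup A :=
  ProfiniteGrp.ProfiniteCompletion.etaFn (GrpCat.of (FreeGroup A)) (FreeGroup.of a)

/-- A substitution, with its values read in the free group. -/
def groupHom (φ : Substitution A) : FreeGroup A →* FreeGroup A :=
  FreeGroup.lift fun a => FreeSemigroup.lift FreeGroup.of (φ (FreeSemigroup.of a))

/-- The continuous endomorphism `φ_G` of the free profinite group induced by `φ`. -/
def extend (φ : Substitution A) : FreeProfiniteGroup A →ₜ* FreeProfiniteGroup A :=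
  (ProfiniteGrp.profiniteCompletion.map (GrpCat.ofHom (groupHom φ))).hom

end FreeProfiniteGroup

instance {A : Type*} (R : Set (FreeProfiniteGroup A)) :
    (Subgroup.normalClosure R).topologicalClosure.Normal :=
  Subgroup.is_normal_topologicalClosure _

/-- The profinite group with generators `A` and relators `R`: the quotient of the free profinite
group by the closed normal subgroup generated by `R`. -/
abbrev PresentedProfiniteGroup {A : Type*} (R : Set (FreeProfiniteGroup A)) : Type _ :=
  FreeProfiniteGroup A ⧸ (Subgroup.normalClosure R).topologicalClosure

/-! ## The `ω`-power of a continuous endomorphism -/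

/-- The idempotent power `f^ω` of a continuous endomorphism `f` of a finitely generated profinite
semigroup or group, which is the pointwise limit of the iterates `f^{n!}`. -/
def omegaPow {X : Type*} [TopologicalSpace X] (f : X → X) (x : X) : X :=
  haveI : Nonempty X := ⟨x⟩
  limUnder atTop fun n : ℕ => f^[n.factorial] x

/-! The limit in the definition of `omegaPow` exists in both cases of interest. -/

theorem exists_iterate_factorial_eq {Y : Type*} [Finite Y] (T : Y → Y) (y : Y) :
    ∃ z, ∀ᶠ n : ℕ in atTop, T^[n.factorial] y = z := by
  obtain ⟨i, j, hij, h⟩ : ∃ i j : ℕ, i < j ∧ T^[i] y = T^[j] y := by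
    obtain ⟨i, j, hne, h⟩ := Finite.exists_ne_map_eq_of_infinite fun k : ℕ => T^[k] y
    rcases lt_or_gt_of_ne hne with h' | h'
    exacts [⟨i, j, h', h⟩, ⟨j, i, h', h.symm⟩]
  obtain ⟨p, hp, rfl⟩ : ∃ p, 0 < p ∧ j = i + p := ⟨j - i, by omega, by omega⟩
  have h1 : ∀ k, T^[i + k + p] y = T^[i + k] y := by
    intro k
    rw [show i + k + p = k + (i + p) by ring, show i + k = k + i by ring,
      Function.iterate_add_apply, ← h, ← Function.iterate_add_apply]
  have h2 : ∀ m k, T^[i + k + m * p] y = T^[i + k] y := by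
    intro m
    induction m with
    | zero => simp
    | succ m ih =>
      intro k
      rw [show i + k + (m + 1) * p = i + (k + m * p) + p by ring, h1, ← add_assoc, ih]
  refine ⟨T^[(i + p).factorial] y, eventually_atTop.2 ⟨i + p, fun n hn => ?_⟩⟩
  obtain ⟨m, hm⟩ := Nat.factorial_dvd_factorial hn
  have hpd : p ∣ (i + p).factorial := Nat.dvd_factorial hp (by omega)
  obtain ⟨q, hq⟩ := hpd
  have hle : i + p ≤ (i + p).factorial := Nat.self_le_factorial _
  have hm0 : m ≠ 0 := by
    rintro rfl
    exact Nat.factorial_ne_zero n (by simpa using hm)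
  obtain ⟨m, rfl⟩ := Nat.exists_eq_succ_of_ne_zero hm0
  obtain ⟨k, hk⟩ := Nat.exists_eq_add_of_le (show i ≤ (i + p).factorial by omega)
  have : n.factorial = i + k + (q * m) * p := by
    rw [hm, ← hk, Nat.succ_eq_add_one, mul_add, mul_one, add_comm]
    congr 1
    conv_lhs => rw [hq]
    ring
  rw [this, h2, ← hk]

theorem finite_range_of_factors {R Y : Type*} [Finite R] {g : ℕ → Y} (r : ℕ → R)
    (h : ∀ k l, r k = r l → g k = g l) : (Set.range g).Finite := by
  have hf : Function.FactorsThrough g r := fun k l => h k l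
  refine (Set.finite_range (Function.extend r g fun _ => g 0)).subset ?_
  rintro _ ⟨k, rfl⟩
  exact ⟨r k, hf.extend_apply _ k⟩

/-- The sequence `f^{n!}(x)` converges as soon as the topology of the compact space `X` is given by
maps `q i` to finite sets, each of which has finitely many composites with iterates of `f`. -/
theorem tendsto_omegaPow_of_finite {X ι : Type*} [TopologicalSpace X] [CompactSpace X]
    (f : X → X) {Q : ι → Type*} (q : ∀ i, X → Q i)
    (hq : ∀ i z, IsOpen (q i ⁻¹' {z})) (hsep : ∀ x y, (∀ i, q i x = q i y) → x = y)
    (hfin : ∀ i, (Set.range fun k : ℕ => q i ∘ f^[k]).Finite) (x : X) :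
    Tendsto (fun n : ℕ => f^[n.factorial] x) atTop (𝓝 (omegaPow f x)) := by
  have : Nonempty X := ⟨x⟩
  have h1 : ∀ i, ∃ z, ∀ᶠ n : ℕ in atTop, q i (f^[n.factorial] x) = z := by
    intro i
    have : Finite (Set.range fun k : ℕ => q i ∘ f^[k]) := hfin i
    let T : (Set.range fun k : ℕ => q i ∘ f^[k]) → (Set.range fun k : ℕ => q i ∘ f^[k]) :=
      fun g => ⟨g.1 ∘ f, by
        obtain ⟨_, k, rfl⟩ := g
        exact ⟨k + 1, rfl⟩⟩
    have hT : ∀ k, (T^[k] ⟨q i, 0, rfl⟩).1 = q i ∘ f^[k] := by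
      intro k
      induction k with
      | zero => rfl
      | succ k ih => rw [Function.iterate_succ_apply']; simp only [T, ih]; rfl
    obtain ⟨z, hz⟩ := exists_iterate_factorial_eq T ⟨q i, 0, rfl⟩
    refine ⟨z.1 x, hz.mono fun n hn => ?_⟩
    rw [← hn, hT]; rfl
  choose z hz using h1
  have h2 : ∀ y, MapClusterPt y atTop (fun n : ℕ => f^[n.factorial] x) → ∀ i, q i y = z i := by
    intro y hy i
    have h3 := hy.frequently ((hq i (q i y)).mem_nhds rfl)
    obtain ⟨n, hn1, hn2⟩ := (h3.and_eventually (hz i)).exists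
    exact (hn1 : _ = q i y).symm.trans hn2
  obtain ⟨y, hy⟩ := exists_clusterPt_of_compactSpace (map (fun n : ℕ => f^[n.factorial] x) atTop)
  have h4 : Tendsto (fun n : ℕ => f^[n.factorial] x) atTop (𝓝 y) :=
    le_nhds_of_unique_clusterPt fun y' hy' => hsep _ _ fun i => (h2 y' hy' i).trans (h2 y hy i).symm
  exact tendsto_nhds_limUnder ⟨y, h4⟩

namespace FreeProfiniteSemigroup

variable {A : Type*}

instance : CompactSpace (FreeProfiniteSemigroup A) := by
  have hd : ∀ c : FiniteCon A, DiscreteTopology c.1.Quotient := fun _ => ⟨rfl⟩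
  have hf : ∀ c : FiniteCon A, Finite c.1.Quotient := fun c => c.2
  refine isCompact_iff_compactSpace.1 (IsClosed.isCompact ?_)
  have h : ((freeProfiniteSemigroup A : Subsemigroup _) : Set (∀ c : FiniteCon A, c.1.Quotient)) =
      ⋂ (c : FiniteCon A) (d : FiniteCon A) (_ : c.1 ≤ d.1) (w : FreeSemigroup A),
        {x | x c = (w : c.1.Quotient) → x d = (w : d.1.Quotient)} := by
    ext x
    simp only [Set.mem_iInter]
    rfl
  rw [h]
  refine isClosed_iInter fun c => isClosed_iInter fun d => isClosed_iInter fun h =>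
    isClosed_iInter fun w => ?_
  have h1 : IsOpen ((fun x : ∀ c : FiniteCon A, c.1.Quotient => x c) ⁻¹' {(w : c.1.Quotient)}) :=
    (isOpen_discrete _).preimage (continuous_apply c)
  have h2 : IsClosed ((fun x : ∀ c : FiniteCon A, c.1.Quotient => x d) ⁻¹' {(w : d.1.Quotient)}) :=
    (isClosed_discrete _).preimage (continuous_apply d)
  exact isClosed_imp h1 h2

theorem denseRange_ofWord : DenseRange (ofWord (A := A)) := by
  refine dense_iff_inter_open.2 ?_
  rintro U ⟨s, hs, rfl⟩ ⟨x, hx⟩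
  obtain ⟨I, t, h1, h2⟩ := isOpen_pi_iff.1 hs x.1 hx
  let d : Con (FreeSemigroup A) := sInf ((fun c : FiniteCon A => c.1) '' (I : Set (FiniteCon A)))
  have hd : ∀ c ∈ I, d ≤ c.1 := fun c hc => sInf_le ⟨c, hc, rfl⟩
  have hfin : Finite d.Quotient := by
    have : ∀ c : I, Finite (Quotient c.1.1.toSetoid) := fun c => c.1.2
    refine Finite.of_injective (fun (z : d.Quotient) (c : I) =>
      Quotient.map (sb := c.1.1.toSetoid) id (fun _ _ h => hd c.1 c.2 h) z) ?_
    intro y z hyz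
    induction y using Quotient.inductionOn with | _ y
    induction z using Quotient.inductionOn with | _ z
    refine (Con.eq d).2 ?_
    rintro _ ⟨c, hc, rfl⟩
    exact (Con.eq c.1).1 (congrFun hyz ⟨c, hc⟩)
  obtain ⟨w, hw⟩ := Quotient.exists_rep (x.1 ⟨d, hfin⟩)
  refine ⟨ofWord w, h2 fun c hc => ?_, w, rfl⟩
  have h3 : x.1 c = (w : c.1.Quotient) := x.2 ⟨d, hfin⟩ c (hd c hc) w hw.symm
  have h4 := (h1 c hc).2
  rwa [h3] at h4

/-- The limit that defines `φ^ω` on the free profinite semigroup exists. -/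
theorem tendsto_omegaPow [Finite A] (φ : Substitution A) (x : FreeProfiniteSemigroup A) :
    Tendsto (fun n : ℕ => (extend φ)^[n.factorial] x) atTop (𝓝 (omegaPow (extend φ) x)) := by
  have hd : ∀ c : FiniteCon A, DiscreteTopology c.1.Quotient := fun _ => ⟨rfl⟩
  have hf : ∀ c : FiniteCon A, Finite c.1.Quotient := fun c => c.2
  refine tendsto_omegaPow_of_finite _ (fun (c : FiniteCon A) x => x.1 c) ?_ ?_ ?_ x
  · exact fun c z => (isOpen_discrete {z}).preimage
      ((continuous_apply c).comp continuous_subtype_val)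
  · exact fun x y h => Subtype.ext (funext h)
  intro c
  refine finite_range_of_factors (fun k a => ((extend φ)^[k] (ofWord (FreeSemigroup.of a))).1 c) ?_
  intro k l hkl
  have hc : ∀ k, Continuous fun x : FreeProfiniteSemigroup A => ((extend φ)^[k] x).1 c := fun k =>
    (continuous_apply c).comp (continuous_subtype_val.comp ((continuous_extend φ).iterate k))
  refine denseRange_ofWord.equalizer (hc k) (hc l) (funext fun w => ?_)
  have hw : ∀ k w, (extend φ)^[k] (ofWord w) = ofWord (φ^[k] w) := fun k w =>
    ((Function.Semiconj.iterate_right (f := ofWord) (ga := φ) (gb := extend φ)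
      (fun _ => rfl) k) w).symm
  have hm : ∀ k (u v : FreeSemigroup A), φ^[k] (u * v) = φ^[k] u * φ^[k] v := fun k =>
    Function.Semiconj₂.iterate (fun u v => map_mul φ u v) k
  change ((extend φ)^[k] (ofWord w)).1 c = ((extend φ)^[l] (ofWord w)).1 c
  induction w using FreeSemigroup.recOnMul with
  | ih1 a => exact congrFun hkl a
  | ih2 a v ha hv =>
    rw [hw, hw] at ha hv ⊢
    rw [hm, hm]
    exact congrArg₂ (· * ·) ha hv

end FreeProfiniteSemigroup

namespace FreeProfiniteGroup

variable {A : Type*}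

/-- The limit that defines `φ_G^ω` on the free profinite group exists. -/
theorem tendsto_omegaPow [Finite A] (φ : Substitution A) (x : FreeProfiniteGroup A) :
    Tendsto (fun n : ℕ => (extend φ)^[n.factorial] x) atTop (𝓝 (omegaPow (extend φ) x)) := by
  refine tendsto_omegaPow_of_finite _
    (fun (U : OpenNormalSubgroup (FreeProfiniteGroup A)) x => (x : _ ⧸ U.toSubgroup)) ?_ ?_ ?_ x
  · intro U z
    have : DiscreteTopology (FreeProfiniteGroup A ⧸ U.toSubgroup) :=
      QuotientGroup.discreteTopology U.isOpen'
    exact (isOpen_discrete {z}).preimage continuous_quot_mk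
  · intro x y h
    by_contra hne
    obtain ⟨U, hU⟩ := ProfiniteGrp.exist_openNormalSubgroup_sub_open_nhds_of_one
      (isOpen_compl_singleton (x := x⁻¹ * y)) (by
        intro h1
        exact hne (inv_mul_eq_one.1 h1.symm))
    exact hU (QuotientGroup.eq.1 (h U)) rfl
  · intro U
    have hdisc : DiscreteTopology (FreeProfiniteGroup A ⧸ U.toSubgroup) :=
      QuotientGroup.discreteTopology U.isOpen'
    have hfin : Finite (FreeProfiniteGroup A ⧸ U.toSubgroup) := finite_of_compact_of_discrete
    refine finite_range_of_factors
      (fun k a => (((extend φ)^[k] (of a) : FreeProfiniteGroup A) : _ ⧸ U.toSubgroup)) ?_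
    intro k l hkl
    let η : FreeGroup A →* FreeProfiniteGroup A :=
      (ProfiniteGrp.ProfiniteCompletion.eta (GrpCat.of (FreeGroup A))).hom
    have hη : DenseRange η := ProfiniteGrp.ProfiniteCompletion.denseRange _
    have hc : ∀ k, Continuous fun x : FreeProfiniteGroup A =>
        (((extend φ)^[k] x : FreeProfiniteGroup A) : _ ⧸ U.toSubgroup) := fun k =>
      continuous_quot_mk.comp ((extend φ).continuous_toFun.iterate k)
    let F : ℕ → FreeProfiniteGroup A →* FreeProfiniteGroup A := fun k =>
      Nat.rec (MonoidHom.id _) (fun _ g => g.comp (extend φ).toMonoidHom) k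
    have hF : ∀ k x, F k x = (extend φ)^[k] x := by
      intro k
      induction k with
      | zero => exact fun _ => rfl
      | succ k ih => exact fun x => ih (extend φ x)
    refine hη.equalizer (hc k) (hc l) (funext fun w => ?_)
    have h1 : ((QuotientGroup.mk' U.toSubgroup).comp (F k)).comp η =
        ((QuotientGroup.mk' U.toSubgroup).comp (F l)).comp η := by
      ext a
      have := congrFun hkl a
      simp only [← hF] at this
      exact this
    have h2 := DFunLike.congr_fun h1 w
    simp only [MonoidHom.comp_apply, hF] at h2
    exact h2

end FreeProfiniteGroup

/-! ## Maximal subgroups of a semigroup -/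

/-- The maximal subgroup of the semigroup `S` at the idempotent `e`: the group of units of `eSe`. -/
def MaximalSubgroup {S : Type*} [Semigroup S] {e : S} (_ : IsIdempotentElem e) : Type _ :=
  {x : S // (e * x = x ∧ x * e = x) ∧ ∃ y, (e * y = y ∧ y * e = y) ∧ x * y = e ∧ y * x = e}

namespace MaximalSubgroup

variable {S : Type*} [Semigroup S] {e : S} {he : IsIdempotentElem e}

instance : Group (MaximalSubgroup he) where
  mul x y := ⟨x.1 * y.1, ⟨by rw [← mul_assoc, x.2.1.1], by rw [mul_assoc, y.2.1.2]⟩, by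
    obtain ⟨x', ⟨hx3, hx4⟩, hx5, hx6⟩ := x.2.2
    obtain ⟨y', ⟨hy3, hy4⟩, hy5, hy6⟩ := y.2.2
    refine ⟨y' * x', ⟨by rw [← mul_assoc, hy3], by rw [mul_assoc, hx4]⟩, ?_, ?_⟩
    · calc x.1 * y.1 * (y' * x') = x.1 * (y.1 * y') * x' := by simp only [mul_assoc]
        _ = e := by rw [hy5, x.2.1.2, hx5]
    · calc y' * x' * (x.1 * y.1) = y' * (x' * x.1) * y.1 := by simp only [mul_assoc]
        _ = e := by rw [hx6, hy4, hy6]⟩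
  one := ⟨e, ⟨he, he⟩, e, ⟨he, he⟩, he, he⟩
  inv x := ⟨x.2.2.choose, x.2.2.choose_spec.1, x.1, x.2.1, x.2.2.choose_spec.2.2,
    x.2.2.choose_spec.2.1⟩
  mul_assoc x y z := Subtype.ext (mul_assoc x.1 y.1 z.1)
  one_mul x := Subtype.ext x.2.1.1
  mul_one x := Subtype.ext x.2.1.2
  inv_mul_cancel x := Subtype.ext x.2.2.choose_spec.2.2

/-- The topology of a maximal subgroup is induced by that of the semigroup. -/
instance [TopologicalSpace S] : TopologicalSpace (MaximalSubgroup he) := instTopologicalSpaceSubtype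

end MaximalSubgroup

/-! ## The `J`-class of the subshift of a substitution -/

namespace Substitution

variable {A : Type*}

/-- The `J`-class `J(φ)` of the free profinite semigroup: the infinite elements of the closure of
the language of the subshift of `φ`. -/
def jClass (φ : Substitution A) : Set (FreeProfiniteSemigroup A) :=
  closure (FreeProfiniteSemigroup.ofWord '' φ.language) \
    (FreeProfiniteSemigroup.ofWord '' φ.language)

/-- The finite words that are factors of elements of `J(φ)`. -/
def jFactors (φ : Substitution A) : Set (FreeSemigroup A) :=
  {w | ∃ x ∈ φ.jClass, ∃ s t : WithOne (FreeProfiniteSemigroup A),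
    (x : WithOne (FreeProfiniteSemigroup A)) = s * (FreeProfiniteSemigroup.ofWord w : _) * t}

/-- The relators `φ_G^ω(a) a⁻¹`, one for each letter `a`. -/
def relators (φ : Substitution A) : Set (FreeProfiniteGroup A) :=
  Set.range fun a : A =>
    omegaPow (FreeProfiniteGroup.extend φ) (FreeProfiniteGroup.of a) * (FreeProfiniteGroup.of a)⁻¹

end Substitution

end

/-! All the elements `φ^ω(c)` lie in one maximal subgroup H of J(φ), and the theorem says that the
continuous homomorphism Θ from the free profinite group to H with Θ(c) = `φ^ω(c)` is onto and has
the expected kernel.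

The subgroup. All words `φ(c)` begin with the same letter a and end with the same letter b, so every
`φ^ω(c)` is a right multiple of `φ^ω(a)` and a left multiple of `φ^ω(b)`. The word ba lies in the
language, so the elements of J(φ) of this shape form a compact semigroup `hClass`. By stability of
compact semigroups an idempotent e of it is an identity for the whole set, and e is fixed by φ
(`exists_idempotent`). Weak primitivity enters through uniform recurrence: every word of the
language is a factor of every element of J(φ), so any two elements of J(φ) divide each other.

Surjectivity. This is where bounded delay is used. A long word of the language is an image up to
short ends, so x in H has the form sφ(z)t with s, t short words. Since e = φ(e), x is also
φ(e)sφ(z)tφ(e). In an image, any long image has a common cutting point (`Delay.sync`); together with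
injectivity this allows the junctions around s and t to be desubstituted, first for words and then
for limits along an ultrafilter (`exists_junction`). Hence x = φ(y) with y again in H. By iteration
x is in the image of every iterate of φ, thus a limit of elements `φ^ω(w)` (`mem_closure_omegaPow`),
which are products of the generators.

Kernel. The relators are killed because `φ^ω` is idempotent (`omegaPow_gen`). Conversely, let q be a
continuous homomorphism to a finite group that kills the relators. Its restriction to words extends
to a continuous κ on the free profinite semigroup, and κ(`φ^ω(a)`) = q(`φ_G^ω(a)`) = q(a). So q = κ
∘ Θ vanishes on the kernel of Θ, and finite quotients detect closed normal subgroups. -/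

/-! ## Combinatorics of lists under a substitution -/

namespace ListSubst

variable {A : Type*}

/-- The action on lists of the substitution with letter images `f`. -/
def map (f : A → List A) (l : List A) : List A := l.flatMap f

/-- The list version of the language of a substitution. -/
def lang (f : A → List A) : Set (List A) := {w | ∃ᶠ k in atTop, ∃ a, w <:+: (map f)^[k] [a]}

variable {f : A → List A}

@[simp] theorem map_nil : map f [] = [] := rfl

@[simp] theorem map_cons (a : A) (l : List A) : map f (a :: l) = f a ++ map f l := rfl

@[simp] theorem map_append (u v : List A) : map f (u ++ v) = map f u ++ map f v :=
  List.flatMap_append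

theorem map_singleton (a : A) : map f [a] = f a := by simp

theorem length_le_map (hf : ∀ a, f a ≠ []) (l : List A) : l.length ≤ (map f l).length := by
  induction l with
  | nil => simp
  | cons a l ih =>
    have := List.length_pos_iff.2 (hf a)
    simp only [map_cons, List.length_append, List.length_cons]
    omega

theorem map_ne_nil (hf : ∀ a, f a ≠ []) {l : List A} (hl : l ≠ []) : map f l ≠ [] := by
  have h1 := length_le_map hf l
  have h2 := List.length_pos_iff.2 hl
  exact List.length_pos_iff.1 (by omega)

theorem iterate_append (k : ℕ) (u v : List A) :
    (map f)^[k] (u ++ v) = (map f)^[k] u ++ (map f)^[k] v :=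
  Function.Semiconj₂.iterate (op := (· ++ ·)) (fun u v => map_append u v) k u v

theorem iterate_nil (k : ℕ) : (map f)^[k] [] = [] :=
  Function.iterate_fixed rfl k

theorem iterate_eq_map (k : ℕ) (u : List A) :
    (map f)^[k] u = map (fun c => (map f)^[k] [c]) u := by
  induction u with
  | nil => exact iterate_nil k
  | cons a u ih =>
    rw [← List.singleton_append, iterate_append, ih]
    rfl

theorem iterate_ne_nil (hf : ∀ a, f a ≠ []) (k : ℕ) {l : List A} (hl : l ≠ []) :
    (map f)^[k] l ≠ [] := by
  induction k generalizing l with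
  | zero => exact hl
  | succ k ih => exact ih (map_ne_nil hf hl)

theorem length_le_iterate (hf : ∀ a, f a ≠ []) (k : ℕ) (l : List A) :
    l.length ≤ ((map f)^[k] l).length := by
  rw [iterate_eq_map]
  exact length_le_map (fun a => iterate_ne_nil hf k (List.cons_ne_nil _ _)) l

theorem map_infix {u v : List A} (h : u <:+: v) : map f u <:+: map f v := by
  obtain ⟨s, t, rfl⟩ := h
  exact ⟨map f s, map f t, by simp⟩

theorem iterate_infix (k : ℕ) {u v : List A} (h : u <:+: v) :
    (map f)^[k] u <:+: (map f)^[k] v := by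
  rw [iterate_eq_map, iterate_eq_map]
  exact map_infix h

/-- A short factor of the image of a list of length at least two lies in the image of a factor of
length two. -/
theorem exists_pair_of_infix_map {w : List A} (hw : ∀ c, w.length ≤ (f c).length + 1)
    {u : List A} (hu : 2 ≤ u.length) (h : w <:+: map f u) :
    ∃ c d, [c, d] <:+: u ∧ w <:+: f c ++ f d := by
  induction u with
  | nil => simp at hu
  | cons c u ih =>
    cases u with
    | nil => simp at hu
    | cons d u =>
      have first : [c, d] <:+: c :: d :: u := ⟨[], u, rfl⟩
      rw [map_cons, List.infix_append_iff_ne_nil] at h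
      rcases h with h | h | ⟨t, t', ht, -, rfl, h1, h2⟩
      · exact ⟨c, d, first, List.infix_append_of_infix_left h⟩
      · cases u with
        | nil => exact ⟨c, d, first, List.infix_append_of_infix_right (by simpa using h)⟩
        | cons e u =>
          obtain ⟨c', d', h3, h4⟩ := ih (by simp) h
          exact ⟨c', d', List.infix_cons h3, h4⟩
      -- Here w = t ++ t' straddles the end of `f c`. As t has at least one letter, t' has at most
      -- |f d| letters and stays inside `f d`; this is why the bound on w allows one extra letter.
      · refine ⟨c, d, first, List.infix_append_iff.2 (Or.inr (Or.inr ⟨t, t', rfl, h1, ?_⟩))⟩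
        have h3 := hw d
        have h4 := List.length_pos_iff.2 ht
        rw [List.length_append] at h3
        rw [map_cons] at h2
        exact List.prefix_of_prefix_length_le h2 (List.prefix_append _ _) (by omega)

/-- A long factor of the image of a list contains the image of a letter. -/
theorem exists_image_infix {B : ℕ} (hB : ∀ c, (f c).length ≤ B) (hB0 : 0 < B) {v : List A}
    (hv : 2 * B ≤ v.length) {u : List A} (h : v <:+: map f u) : ∃ c ∈ u, f c <:+: v := by
  induction u with
  | nil =>
    have := h.length_le
    simp only [map_nil, List.length_nil] at this
    omega
  | cons c u ih =>
    rw [map_cons, List.infix_append_iff] at h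
    rcases h with h | h | ⟨t, t', rfl, h1, h2⟩
    · have h1 := h.length_le
      have h2 := hB c
      omega
    · obtain ⟨d, hd, h⟩ := ih h
      exact ⟨d, List.mem_cons_of_mem _ hd, h⟩
    · have h3 := h1.length_le
      have h4 := hB c
      rw [List.length_append] at hv
      cases u with
      | nil =>
        have := h2.length_le
        simp only [map_nil, List.length_nil] at this
        omega
      | cons d u =>
        refine ⟨d, by simp, List.infix_append_of_infix_right ?_⟩
        rw [map_cons] at h2
        have h5 := hB d
        exact (List.prefix_of_prefix_length_le (List.prefix_append _ _) h2 (by omega)).isInfix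

theorem lang_infix {u v : List A} (hv : v ∈ lang f) (h : u <:+: v) : u ∈ lang f :=
  Frequently.mono hv fun _ ⟨a, ha⟩ => ⟨a, h.trans ha⟩

theorem map_mem_lang {w : List A} (hw : w ∈ lang f) : map f w ∈ lang f := by
  refine frequently_atTop.2 fun N => ?_
  obtain ⟨k, hk, a, h⟩ := frequently_atTop.1 hw N
  refine ⟨k + 1, by omega, a, ?_⟩
  rw [Function.iterate_succ_apply']
  exact map_infix h

theorem iterate_mem_lang {w : List A} (hw : w ∈ lang f) (k : ℕ) : (map f)^[k] w ∈ lang f := by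
  induction k generalizing w with
  | zero => exact hw
  | succ k ih => exact ih (map_mem_lang hw)

/-- The list version of weak primitivity. -/
structure WeaklyPrimitive (f : A → List A) (n : ℕ) : Prop where
  ne_nil : ∀ a, f a ≠ []
  two_le : ∀ a, 2 ≤ ((map f)^[n] [a]).length
  pairs : ∀ a b x y, [x, y] <:+: (map f)^[n] [a] → [x, y] <:+: (map f)^[n] [b]

namespace WeaklyPrimitive

variable {n : ℕ}

theorem two_pow_le (hp : WeaklyPrimitive f n) (k : ℕ) (a : A) :
    2 ^ k ≤ ((map f)^[n * k] [a]).length := by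
  have key : ∀ l : List A, 2 * l.length ≤ ((map f)^[n] l).length := by
    intro l
    induction l with
    | nil => simp
    | cons a l ih =>
      rw [← List.singleton_append, iterate_append, List.length_append, List.length_append]
      have := hp.two_le a
      simp only [List.length_cons, List.length_nil] at *
      omega
  induction k with
  | zero => simp
  | succ k ih =>
    rw [show n * (k + 1) = n + n * k by ring, Function.iterate_add_apply, pow_succ]
    have := key ((map f)^[n * k] [a])
    omega

theorem exists_length_le (hp : WeaklyPrimitive f n) (N : ℕ) :
    ∃ K, ∀ k ≥ K, ∀ a, N ≤ ((map f)^[k] [a]).length := by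
  refine ⟨n * N, fun k hk a => ?_⟩
  obtain ⟨j, rfl⟩ := Nat.exists_eq_add_of_le hk
  rw [add_comm, Function.iterate_add_apply]
  exact (Nat.lt_two_pow_self.le.trans (hp.two_pow_le N a)).trans (length_le_iterate hp.ne_nil _ _)

/-- With k = n + j, a pair of consecutive letters in the k-th iterate lies in the j-th iterate of a
pair occurring in the n-th iterate, and the latter pair occurs for every starting letter. -/
theorem pairs_iterate (hp : WeaklyPrimitive f n) {k : ℕ} (hk : n ≤ k) {a x y : A}
    (h : [x, y] <:+: (map f)^[k] [a]) (b : A) : [x, y] <:+: (map f)^[k] [b] := by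
  obtain ⟨j, rfl⟩ := Nat.exists_eq_add_of_le hk
  rw [add_comm, Function.iterate_add_apply] at h ⊢
  rw [iterate_eq_map] at h
  obtain ⟨c, d, h1, h2⟩ := exists_pair_of_infix_map (fun c => by
    have := length_le_iterate hp.ne_nil j [c]
    simpa using this) (hp.two_le a) h
  have h3 := hp.pairs a b c d h1
  refine List.IsInfix.trans ?_ (iterate_infix j h3)
  rw [iterate_eq_map]
  simpa using h2

/-- For j so large that j-th iterates of letters are at least as long as w, an occurrence of w lies
in the j-th iterate of a pair, and pairs are the same for all starting letters by `pairs_iterate`.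
-/
theorem frequently_infix (hp : WeaklyPrimitive f n) {w : List A} (hw : w ∈ lang f) :
    ∃ᶠ m in atTop, ∀ b, w <:+: (map f)^[m] [b] := by
  obtain ⟨j, hj⟩ := hp.exists_length_le w.length
  refine frequently_atTop.2 fun N => ?_
  obtain ⟨m, hm, a, h⟩ := frequently_atTop.1 hw (N + j + n)
  refine ⟨m, by omega, fun b => ?_⟩
  obtain ⟨i, rfl⟩ := Nat.exists_eq_add_of_le (show j ≤ m by omega)
  have hi : n ≤ i := by omega
  have h2 : 2 ≤ ((map f)^[i] [a]).length := by
    obtain ⟨l, rfl⟩ := Nat.exists_eq_add_of_le hi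
    rw [add_comm, Function.iterate_add_apply]
    exact (hp.two_le a).trans (length_le_iterate hp.ne_nil _ _)
  rw [Function.iterate_add_apply] at h ⊢
  rw [iterate_eq_map] at h
  obtain ⟨c, d, h3, h4⟩ := exists_pair_of_infix_map
    (fun c => (hj j le_rfl c).trans (Nat.le_succ _)) h2 h
  refine List.IsInfix.trans ?_ (iterate_infix j (hp.pairs_iterate hi h3 b))
  rw [iterate_eq_map]
  simpa using h4

/-- Uniform recurrence. -/
theorem recurrent [Finite A] (hp : WeaklyPrimitive f n) {w : List A} (hw : w ∈ lang f) :
    ∃ N, ∀ v ∈ lang f, N ≤ v.length → w <:+: v := by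
  obtain ⟨m, hm⟩ := (hp.frequently_infix hw).exists
  obtain ⟨B, hB⟩ := (Set.finite_range fun c => ((map f)^[m] [c]).length).bddAbove
  have hB' : ∀ c, ((map f)^[m] [c]).length ≤ B + 1 := fun c => (hB ⟨c, rfl⟩).trans (Nat.le_succ B)
  -- A factor of this length of an m-th iterate contains the full m-th iterate of some letter, hence
  -- w. The bound B + 1 is used because it must be positive.
  refine ⟨2 * (B + 1), fun v hv hlen => ?_⟩
  obtain ⟨k, hk, a, h⟩ := frequently_atTop.1 hv m
  obtain ⟨i, rfl⟩ := Nat.exists_eq_add_of_le hk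
  rw [Function.iterate_add_apply, iterate_eq_map] at h
  obtain ⟨c, -, hc⟩ := exists_image_infix hB' (Nat.succ_pos B) hlen h
  exact (hm c).trans hc

/-- Nonempty contexts on both sides are needed because factorisations will be taken in a semigroup
without identity; they are obtained by removing the first and last letters of v beforehand. -/
theorem recurrent_interior [Finite A] (hp : WeaklyPrimitive f n) {w : List A} (hw : w ∈ lang f) :
    ∃ N, ∀ v ∈ lang f, N ≤ v.length → ∃ s t, s ≠ [] ∧ t ≠ [] ∧ v = s ++ w ++ t := by
  obtain ⟨N, hN⟩ := hp.recurrent hw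
  refine ⟨N + 2, fun v hv hlen => ?_⟩
  cases v with
  | nil => simp at hlen
  | cons x v =>
    rcases List.eq_nil_or_concat v with rfl | ⟨v, y, rfl⟩
    · simp at hlen
    · rw [List.concat_eq_append] at *
      obtain ⟨s, t, h⟩ := hN v (lang_infix hv ⟨[x], [y], by simp⟩) (by simp at hlen; omega)
      exact ⟨x :: s, t ++ [y], by simp, by simp, by simp [← h]⟩

end WeaklyPrimitive

/-! ### Cutting images of lists -/

/-- A position in an image either is a boundary between images of letters or is strictly inside the
image of a letter d. -/
theorem exists_cut {v : List A} {k : ℕ} (hk : k ≤ (map f v).length) :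
    (∃ v₁ v₂, v = v₁ ++ v₂ ∧ (map f v₁).length = k) ∨
    ∃ v₁ d v₂, v = v₁ ++ d :: v₂ ∧ (map f v₁).length < k ∧
      k < (map f v₁).length + (f d).length := by
  induction v generalizing k with
  | nil => exact Or.inl ⟨[], [], rfl, by simp at hk; simp [hk]⟩
  | cons c v ih =>
    rcases Nat.eq_zero_or_pos k with rfl | h0
    · exact Or.inl ⟨[], c :: v, rfl, rfl⟩
    rcases lt_or_ge k (f c).length with h | h
    · exact Or.inr ⟨[], c, v, rfl, h0, by simpa using h⟩
    rw [map_cons, List.length_append] at hk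
    rcases ih (k := k - (f c).length) (by omega) with ⟨v₁, v₂, rfl, h1⟩ | ⟨v₁, d, v₂, rfl, h1, h2⟩
    · exact Or.inl ⟨c :: v₁, v₂, rfl, by simp; omega⟩
    · by_cases h3 : v₁ = [] ∧ k = (f c).length
      · exact Or.inl ⟨[c], d :: v₂, by simp [h3.1], by simp [h3.2]⟩
      · exact Or.inr ⟨c :: v₁, d, v₂, rfl, by simp; omega, by simp; omega⟩

theorem exists_cut_le {M : ℕ} (hM : ∀ a, (f a).length ≤ M) (hM0 : 0 < M) {v : List A} {k : ℕ}
    (hk : k ≤ (map f v).length) :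
    ∃ v₁ v₂, v = v₁ ++ v₂ ∧ k ≤ (map f v₁).length ∧ (map f v₁).length < k + M := by
  rcases exists_cut hk with ⟨v₁, v₂, h, h1⟩ | ⟨v₁, d, v₂, h, h1, h2⟩
  · exact ⟨v₁, v₂, h, h1.ge, by omega⟩
  · have := hM d
    refine ⟨v₁ ++ [d], v₂, by simp [h], ?_, ?_⟩ <;>
    · rw [map_append, List.length_append, map_singleton]
      omega

theorem append_eq_append_of_le {u v s t : List A} (h : u ++ v = s ++ t) (hl : s.length ≤ u.length) :
    ∃ r, u = s ++ r ∧ t = r ++ v := by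
  rcases List.append_eq_append_iff.1 h with ⟨r, rfl, rfl⟩ | ⟨r, rfl, rfl⟩
  · have : r = [] := List.length_eq_zero_iff.1 (by simp at hl; simpa using hl)
    subst this
    exact ⟨[], by simp, rfl⟩
  · exact ⟨r, rfl, rfl⟩

/-- Every long word of the language is the image of a word of the language up to short ends. -/
theorem desubstitute {M : ℕ} (hM : ∀ a, (f a).length ≤ M) (hM0 : 0 < M)
    (hpre : ∀ w ∈ lang f, ∃ v ∈ lang f, w <:+: map f v) {w : List A} (hw : w ∈ lang f)
    (hlen : 2 * M + 1 ≤ w.length) :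
    ∃ s z t, w = s ++ map f z ++ t ∧ z ∈ lang f ∧ s ≠ [] ∧ z ≠ [] ∧ t ≠ [] ∧
      s.length ≤ M ∧ t.length ≤ M := by
  obtain ⟨v, hv, X, Y, h⟩ := hpre w hw
  have hL := congrArg List.length h
  simp only [List.length_append] at hL
  -- Cutting at least one letter after the start of w makes s nonempty, of length at most M.
  obtain ⟨v₁, v₂, rfl, h1, h2⟩ := exists_cut_le hM hM0 (v := v) (k := X.length + 1) (by omega)
  rw [List.append_assoc, map_append] at h
  obtain ⟨s, hs, h3⟩ := append_eq_append_of_le h.symm (by omega)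
  have hs' := congrArg List.length hs
  have h3' := congrArg List.length h3
  simp only [List.length_append] at hs' h3'
  -- The overshoot is less than M, so between 1 and M letters remain for t. As |w| ≥ 2M + 1, the
  -- cutting position is positive and z is nonempty.
  obtain ⟨z, v₃, rfl, h4, h5⟩ := exists_cut_le hM hM0 (v := v₂) (k := w.length - s.length - M)
    (by omega)
  rw [map_append, ← List.append_assoc] at h3
  obtain ⟨t, ht, h6⟩ := append_eq_append_of_le h3 (by simp; omega)
  have ht' := congrArg List.length ht
  simp only [List.length_append] at ht'
  refine ⟨s, z, t, ht, lang_infix hv ⟨v₁, v₃, by simp⟩, ?_, ?_, ?_, by omega, by omega⟩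
  · rintro rfl
    simp only [List.length_nil] at hs'
    omega
  · rintro rfl
    simp only [map_nil, List.length_nil] at h4
    omega
  · rintro rfl
    simp only [List.length_nil] at ht'
    omega

end ListSubst

/-! ### Synchronisation of images by bounded delay -/

namespace ListSubst

variable {A : Type*} {f : A → List A}

/-- The list version of bounded delay (only for equalities `u c₁ ⋯ cₘ v = c'₁ ⋯ c'ₙ`), for a code
that is given by its letters. -/
def Delay (f : A → List A) (N : ℕ) : Prop :=
  ∀ (u v cs cs' : List A), u ≠ [] → v ≠ [] → (∃ a, u <:+ f a) → (∃ a, v <+: f a) →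
    N < cs.length + cs'.length → u ++ map f cs ++ v = map f cs' → map f cs' ∈ lang f →
    ∃ r s, r ≤ cs.length ∧ map f (cs.drop r) ++ v = map f (cs'.drop s)

/-- In a word of the language that is an image, any long image is synchronised. -/
theorem Delay.sync {N : ℕ} (hd : Delay f N) (hf : ∀ a, f a ≠ []) {M : ℕ}
    (hM : ∀ a, (f a).length ≤ M) {v X Y p : List A} (hp : N + M < p.length)
    (hv : map f v ∈ lang f) (h : map f v = X ++ map f p ++ Y) :
    ∃ p₁ p₂ v₁ v₂, p = p₁ ++ p₂ ∧ v = v₁ ++ v₂ ∧ map f v₁ = X ++ map f p₁ := by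
  have hL := congrArg List.length h
  simp only [List.length_append] at hL
  have hpl := length_le_map hf p
  rcases exists_cut (f := f) (v := v) (k := X.length) (by omega) with
    ⟨v₁, v₂, rfl, h1⟩ | ⟨v₁, d, v₂, rfl, h1, h2⟩
  · refine ⟨[], p, v₁, v₂, rfl, rfl, ?_⟩
    rw [map_append, List.append_assoc] at h
    simpa using List.append_inj_left h h1
  rw [map_append, List.append_assoc] at h
  obtain ⟨d₁, hd₁, h3⟩ := append_eq_append_of_le h.symm h1.le
  rw [map_cons] at h3
  have hL1 := congrArg List.length hd₁
  rw [List.length_append] at hL1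
  -- The start of `map f p` falls strictly inside `f d` = d₁ ++ u, with u a beginning of `map f p`;
  -- since |p| > M, u is shorter than `map f p`.
  obtain ⟨u, hu, h4⟩ := append_eq_append_of_le h3 (by omega)
  have hL2 := congrArg List.length hu
  rw [List.length_append] at hL2
  have hMd := hM d
  have hL3 := congrArg List.length h4
  simp only [List.length_append] at hL3
  rcases exists_cut (f := f) (v := v₂) (k := (map f p).length - u.length) (by omega) with
    ⟨v₂, v₃, rfl, h5⟩ | ⟨v₂, d', v₃, rfl, h5, h6⟩
  · refine ⟨p, [], v₁ ++ d :: v₂, v₃, by simp, by simp, ?_⟩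
    rw [map_append, ← List.append_assoc] at h4
    have h7 := List.append_inj_left h4 (by rw [List.length_append]; omega)
    rw [h7, hd₁, map_append, map_cons, hu]
    simp
  · rw [map_append, map_cons, ← List.append_assoc] at h4
    obtain ⟨e, he, h7⟩ := append_eq_append_of_le h4 (by rw [List.length_append]; omega)
    have hL4 := congrArg List.length he
    simp only [List.length_append] at hL4
    obtain ⟨e', he', -⟩ := append_eq_append_of_le h7 (by omega)
    -- Both ends of `map f p` are inside images of letters, so `map f p` = u ++ `map f v₂` ++ e is
    -- an equality of the delay type. Its reduction is a common cutting point.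
    obtain ⟨r, s, hr, hrs⟩ := hd u e v₂ p (by rintro rfl; simp at hL2; omega)
      (by rintro rfl; simp at hL4; omega) ⟨d, d₁, hu.symm⟩ ⟨d', e', he'.symm⟩ (by omega) he.symm
      (lang_infix hv ⟨X, Y, by rw [map_append, h]; simp⟩)
    refine ⟨p.take s, p.drop s, v₁ ++ d :: v₂.take r, v₂.drop r ++ d' :: v₃, by simp, by
      rw [List.append_assoc, List.cons_append, ← List.append_assoc (v₂.take r),
        List.take_append_drop], ?_⟩
    have h8 : u ++ map f (v₂.take r) = map f (p.take s) := by
      have h9 : map f p = map f (p.take s) ++ map f (p.drop s) := by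
        rw [← map_append, List.take_append_drop]
      have h10 : map f v₂ = map f (v₂.take r) ++ map f (v₂.drop r) := by
        rw [← map_append, List.take_append_drop]
      rw [h9, h10, ← List.append_assoc u, List.append_assoc (u ++ _), hrs] at he
      exact (List.append_cancel_right he).symm
    rw [map_append, map_cons, hu, hd₁, ← h8]
    simp

/-- If the images of two long lists, separated by a list `s`, form a word of the language, then
`s` together with the images of short ends of these lists is the image of a list `m`, and the two
lists are joined by `m` within the language. -/
theorem Delay.junction {N : ℕ} (hd : Delay f N) (hf : ∀ a, f a ≠ []) {M : ℕ}
    (hM : ∀ a, (f a).length ≤ M) (hinj : Function.Injective (map f))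
    (hpre : ∀ w ∈ lang f, ∃ v ∈ lang f, w <:+: map f v) {D : ℕ} (hD : N + M < D)
    {p₁ p₂ p₃ q₁ q₂ q₃ s : List A}
    (hp₁ : p₁.length = D) (hp₃ : p₃.length = D) (hq₁ : q₁.length = D) (hq₃ : q₃.length = D)
    (h : map f (p₁ ++ p₂ ++ p₃) ++ s ++ map f (q₁ ++ q₂ ++ q₃) ∈ lang f) :
    ∃ p₃' p₃'' q₁' q₁'' m, p₃ = p₃' ++ p₃'' ∧ q₁ = q₁' ++ q₁'' ∧
      map f m = map f p₃'' ++ s ++ map f q₁' ∧ p₂ ++ p₃' ++ m ++ q₁'' ++ q₂ ∈ lang f := by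
  obtain ⟨v, hv, X, Y, hXY⟩ := hpre _ h
  have hv' := map_mem_lang hv
  obtain ⟨a₁, a₂, v₁, v₂, rfl, rfl, e1⟩ := hd.sync hf hM (v := v) (X := X) (p := p₁)
    (Y := map f p₂ ++ map f p₃ ++ s ++ map f (q₁ ++ q₂ ++ q₃) ++ Y) (by omega) hv'
    (by rw [← hXY]; simp)
  rw [map_append v₁ v₂, e1] at hXY
  have e2 : map f v₂ = map f (a₂ ++ p₂) ++ map f p₃ ++
      (s ++ map f (q₁ ++ q₂ ++ q₃) ++ Y) := by
    simpa using hXY.symm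
  have hv₂ : map f v₂ ∈ lang f := lang_infix hv' ⟨map f v₁, [], by simp⟩
  obtain ⟨b₁, b₂, v₃, v₄, rfl, rfl, e3⟩ := hd.sync hf hM (by omega) hv₂ e2
  rw [← map_append] at e3
  -- Between the common cutting points in p₁ and p₃, the preimage v and the given list have the same
  -- image, so they coincide. The same is done for q₁ and q₃ below, and m is the stretch of v from
  -- the cut in p₃ to the cut in q₁.
  obtain rfl := hinj e3
  have e4 : map f v₄ = (map f b₂ ++ s) ++ map f q₁ ++ (map f (q₂ ++ q₃) ++ Y) := by
    simpa using e2
  have hv₄ : map f v₄ ∈ lang f := lang_infix hv₂ ⟨map f (a₂ ++ p₂ ++ b₁), [], by simp⟩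
  obtain ⟨c₁, c₂, m, v₅, rfl, rfl, e5⟩ := hd.sync hf hM (by omega) hv₄ e4
  have e6 : map f v₅ = map f (c₂ ++ q₂) ++ map f q₃ ++ Y := by
    rw [map_append m v₅, e5] at e4
    simpa using e4
  have hv₅ : map f v₅ ∈ lang f := lang_infix hv₄ ⟨map f m, [], by simp⟩
  obtain ⟨d₁, d₂, v₆, v₇, rfl, rfl, e7⟩ := hd.sync hf hM (by omega) hv₅ e6
  rw [← map_append] at e7
  obtain rfl := hinj e7
  exact ⟨b₁, b₂, c₁, c₂, m, rfl, rfl, e5,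
    lang_infix hv ⟨v₁ ++ a₂, d₁ ++ v₇, by simp⟩⟩

end ListSubst

/-! ## Words as lists -/

namespace FreeSemigroup

variable {A : Type*}

theorem toWord_ne_nil (w : FreeSemigroup A) : w.toWord ≠ [] := List.cons_ne_nil _ _

theorem toWord_mul (u v : FreeSemigroup A) : (u * v).toWord = u.toWord ++ v.toWord := rfl

theorem toWord_of (a : A) : (of a).toWord = [a] := rfl

theorem toWord_injective : Function.Injective (toWord (A := A)) := by
  intro u v h
  injection h with h1 h2
  exact FreeSemigroup.ext h1 h2

theorem exists_toWord_eq {l : List A} (hl : l ≠ []) : ∃ w : FreeSemigroup A, w.toWord = l := by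
  obtain ⟨a, l, rfl⟩ := List.exists_cons_of_ne_nil hl
  exact ⟨⟨a, l⟩, rfl⟩

theorem finite_toWord_length_le [Finite A] (n : ℕ) :
    {w : FreeSemigroup A | w.toWord.length ≤ n}.Finite :=
  (List.finite_length_le A n).preimage toWord_injective.injOn

end FreeSemigroup

theorem wordProd_cons {A : Type*} (u : FreeSemigroup A) (us : List (FreeSemigroup A)) :
    wordProd (u :: us) = u.toWord ++ wordProd us := List.flatMap_cons

theorem wordProd_append {A : Type*} (us vs : List (FreeSemigroup A)) :
    wordProd (us ++ vs) = wordProd us ++ wordProd vs := List.flatMap_append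

namespace Substitution

variable {A : Type*} (φ : Substitution A)

/-- The images of the letters under a substitution, as lists. -/
def letters (a : A) : List A := (φ (FreeSemigroup.of a)).toWord

theorem letters_ne_nil (a : A) : φ.letters a ≠ [] := FreeSemigroup.toWord_ne_nil _

theorem toWord_apply (w : FreeSemigroup A) :
    (φ w).toWord = ListSubst.map φ.letters w.toWord := by
  induction w using FreeSemigroup.recOnMul with
  | ih1 a => rw [FreeSemigroup.toWord_of, ListSubst.map_singleton]; rfl
  | ih2 a w _ hw =>
    rw [map_mul, FreeSemigroup.toWord_mul, FreeSemigroup.toWord_mul, ListSubst.map_append, hw,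
      FreeSemigroup.toWord_of, ListSubst.map_singleton]
    rfl

theorem toWord_iterate (k : ℕ) (w : FreeSemigroup A) :
    (φ^[k] w).toWord = (ListSubst.map φ.letters)^[k] w.toWord :=
  Function.Semiconj.iterate_right (f := FreeSemigroup.toWord) (toWord_apply φ) k w

theorem mem_language_iff {w : FreeSemigroup A} :
    w ∈ φ.language ↔ w.toWord ∈ ListSubst.lang φ.letters := by
  simp only [language, ListSubst.lang, iter, toWord_iterate, FreeSemigroup.toWord_of,
    Set.mem_ofPred_eq]

theorem map_letters_injective (h : Function.Injective φ) :
    Function.Injective (ListSubst.map φ.letters) := by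
  intro u v huv
  rcases eq_or_ne u [] with rfl | hu
  · by_contra hv
    exact ListSubst.map_ne_nil φ.letters_ne_nil (Ne.symm hv) huv.symm
  rcases eq_or_ne v [] with rfl | hv
  · exact absurd huv (ListSubst.map_ne_nil φ.letters_ne_nil hu)
  obtain ⟨u, rfl⟩ := FreeSemigroup.exists_toWord_eq hu
  obtain ⟨v, rfl⟩ := FreeSemigroup.exists_toWord_eq hv
  rw [← toWord_apply, ← toWord_apply] at huv
  rw [h (FreeSemigroup.toWord_injective huv)]

variable {φ}

theorem WeaklyPrimitive.exists_letters (h : φ.WeaklyPrimitive) :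
    ∃ n, ListSubst.WeaklyPrimitive φ.letters n := by
  obtain ⟨n, -, h1, h2⟩ := h
  have h3 : ∀ a, (φ.iter n a).toWord = (ListSubst.map φ.letters)^[n] [a] := fun a =>
    toWord_iterate φ n _
  refine ⟨n, φ.letters_ne_nil, fun a => ?_, fun a b x y => ?_⟩
  · rw [← h3]
    exact h1 a
  · rw [← h3, ← h3]
    exact (h2 a b x y).1

theorem length_iterate_letters (n : ℕ) (w : FreeSemigroup A) :
    w.toWord.length ≤ (φ^[n] w).toWord.length := by
  rw [toWord_iterate]
  exact ListSubst.length_le_iterate φ.letters_ne_nil n _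

/-- By recurrence w occurs in some iterate, of positive exponent, of the letter a. The previous
iterate of a is in the language because a is. -/
theorem exists_preimage_of_mem_lang (hp : φ.WeaklyPrimitive) {a : A}
    (ha : [a] ∈ ListSubst.lang φ.letters) :
    ∀ w ∈ ListSubst.lang φ.letters,
      ∃ v ∈ ListSubst.lang φ.letters, w <:+: ListSubst.map φ.letters v := by
  intro w hw
  obtain ⟨n, hn⟩ := hp.exists_letters
  obtain ⟨k, hk, h⟩ := frequently_atTop.1 (hn.frequently_infix hw) 1
  obtain ⟨k, rfl⟩ := Nat.exists_eq_add_of_le' hk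
  refine ⟨_, ListSubst.iterate_mem_lang ha k, ?_⟩
  rw [← Function.iterate_succ_apply' (ListSubst.map φ.letters)]
  exact h a

/-- A reduction that keeps u would equate the product of the c'ⱼ with a proper suffix of itself. So
u is always dropped, and the index r shifts by one to count in `cs`. -/
theorem IsEncodingOfBoundedDelay.exists_delay {L : Set (FreeSemigroup A)}
    (h : φ.IsEncodingOfBoundedDelay L) (hL : φ.language ⊆ L) :
    ∃ N, ListSubst.Delay φ.letters N := by
  obtain ⟨-, N, hN⟩ := h
  have hprod : ∀ l : List A, wordProd (l.map fun a => φ (FreeSemigroup.of a)) =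
      ListSubst.map φ.letters l := fun l => List.flatMap_map _ _ l
  refine ⟨N, fun u v cs cs' hu hv hus hvp hlen heq hmem => ?_⟩
  obtain ⟨u, rfl⟩ := FreeSemigroup.exists_toWord_eq hu
  obtain ⟨v, rfl⟩ := FreeSemigroup.exists_toWord_eq hv
  obtain ⟨a, ha⟩ := hus
  obtain ⟨b, hb⟩ := hvp
  have hne : ListSubst.map φ.letters cs' ≠ [] := by
    rw [← heq]
    simp [FreeSemigroup.toWord_ne_nil]
  obtain ⟨w, hw⟩ := FreeSemigroup.exists_toWord_eq hne
  have hsing : wordProd [v] = v.toWord := by simp [wordProd]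
  obtain ⟨r, s, hr, hs, hrs, h⟩ := (hN u v (cs.map fun a => φ (FreeSemigroup.of a))
    (cs'.map fun a => φ (FreeSemigroup.of a)) (by simp) (by simp) ⟨_, ⟨a, rfl⟩, ha⟩
    ⟨_, ⟨b, rfl⟩, hb⟩ (by simpa using hlen)).1
    (by rw [wordProd_append, wordProd_cons, hprod, hprod, hsing, heq])
    ⟨w, hL ((mem_language_iff φ).2 (by rwa [hw])), by rw [hw, hprod]⟩
  rw [← List.map_drop, hprod] at h
  cases r with
  | zero =>
    rw [List.drop_zero, wordProd_append, wordProd_cons, hprod, hsing, heq] at h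
    have h1 : ListSubst.map φ.letters (cs'.take s) = [] := by
      have h2 := h
      rw [← List.take_append_drop s cs', ListSubst.map_append, List.take_append_drop] at h2
      simpa using h2
    by_contra
    refine ListSubst.map_ne_nil φ.letters_ne_nil (l := cs'.take s) ?_ h1
    rw [List.length_map] at hs
    intro h3
    have h4 := congrArg List.length h3
    rw [List.length_take, List.length_nil] at h4
    omega
  | succ r =>
    simp only [List.cons_append, List.length_cons, List.length_append, List.length_map,
      List.length_nil] at hr
    refine ⟨r, s, by omega, ?_⟩
    rw [← h, List.cons_append, List.drop_succ_cons, List.drop_append_of_le_length (by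
      rw [List.length_map]; omega), wordProd_append, ← List.map_drop, hprod, hsing]

end Substitution

theorem FreeSemigroup.mul_eq_mul_iff {A : Type*} {u v a b : FreeSemigroup A} :
    u * v = a * b ↔ (∃ k, u = a * k ∧ b = k * v) ∨ (u = a ∧ v = b) ∨
      ∃ k, a = u * k ∧ v = k * b := by
  constructor
  · intro h
    have h1 : u.toWord ++ v.toWord = a.toWord ++ b.toWord := congrArg toWord h
    rcases List.append_eq_append_iff.1 h1 with ⟨r, h2, h3⟩ | ⟨r, h2, h3⟩
    · rcases eq_or_ne r [] with rfl | hr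
      · exact Or.inr (Or.inl ⟨(toWord_injective (by simpa using h2)).symm,
          toWord_injective (by simpa using h3)⟩)
      · obtain ⟨k, rfl⟩ := exists_toWord_eq hr
        exact Or.inr (Or.inr ⟨k, toWord_injective h2, toWord_injective h3⟩)
    · rcases eq_or_ne r [] with rfl | hr
      · exact Or.inr (Or.inl ⟨toWord_injective (by simpa using h2),
          (toWord_injective (by simpa using h3)).symm⟩)
      · obtain ⟨k, rfl⟩ := exists_toWord_eq hr
        exact Or.inl ⟨k, toWord_injective h2, toWord_injective h3⟩
  · rintro (⟨k, rfl, rfl⟩ | ⟨rfl, rfl⟩ | ⟨k, rfl, rfl⟩) <;> simp only [mul_assoc]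

theorem Con.finite_quotient_of_map {M T : Type*} [Mul M] [Finite T] (c : Con M) (g : M → T)
    (h : ∀ u v, g u = g v → c u v) : Finite c.Quotient := by
  refine Finite.of_injective (fun q : c.Quotient => g (Quotient.out q)) fun p q hpq => ?_
  rw [← Quotient.out_eq p, ← Quotient.out_eq q]
  exact Quotient.sound (h _ _ hpq)

/-! ### Finite congruences and the topology of the free profinite semigroup -/

namespace FiniteCon

variable {A : Type*}

instance (c : FiniteCon A) : DiscreteTopology c.1.Quotient := ⟨rfl⟩

instance (c : FiniteCon A) : Finite c.1.Quotient := c.2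

/-- The intersection of finitely many congruences of finite index. -/
theorem exists_le (I : Finset (FiniteCon A)) : ∃ d : FiniteCon A, ∀ c ∈ I, d.1 ≤ c.1 := by
  let d : Con (FreeSemigroup A) := sInf ((fun c : FiniteCon A => c.1) '' (I : Set (FiniteCon A)))
  have hd : ∀ c ∈ I, d ≤ c.1 := fun c hc => sInf_le ⟨c, hc, rfl⟩
  refine ⟨⟨d, d.finite_quotient_of_map (fun w (c : I) => (w : c.1.1.Quotient)) ?_⟩, hd⟩
  rintro u v h _ ⟨c, hc, rfl⟩
  exact (Con.eq c.1).1 (congrFun h ⟨c, hc⟩)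

/-- Two words are congruent if they have the same prefix of length `n`. -/
def prefixCon [Finite A] (n : ℕ) : FiniteCon A :=
  ⟨{ r := fun u v => u.toWord.take n = v.toWord.take n
     iseqv := ⟨fun _ => rfl, fun h => h.symm, fun h h' => h.trans h'⟩
     mul' := by
       intro u u' v v' h h'
       have key : ∀ a b : FreeSemigroup A,
           (a * b).toWord.take n = (a.toWord.take n ++ b.toWord.take n).take n := by
         intro a b
         rw [FreeSemigroup.toWord_mul, List.take_append, List.take_append, List.take_take,
           List.take_take, min_self, List.length_take]
         congr 2
         omega
       rw [key, key, h, h'] },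
   haveI : Finite {l : List A // l.length ≤ n} := List.finite_length_le A n
   Con.finite_quotient_of_map _ (fun w : FreeSemigroup A =>
    (⟨w.toWord.take n, List.length_take_le _ _⟩ : {l : List A // l.length ≤ n}))
    fun _ _ h => congrArg Subtype.val h⟩

/-- The class of a word and the classes of the factors of its factorisations. -/
def splitData (c : FiniteCon A) (w : FreeSemigroup A) :
    c.1.Quotient × Set (c.1.Quotient × c.1.Quotient) :=
  (w, {p | ∃ a b : FreeSemigroup A, w = a * b ∧ p = (↑a, ↑b)})

/-- A factorisation of uv cuts inside u, between u and v, or inside v. Hence the data of a product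
depend only on the data of its factors, which makes `splitCon` a congruence. -/
theorem splitData_mul (c : FiniteCon A) (u v : FreeSemigroup A) :
    splitData c (u * v) = ((splitData c u).1 * (splitData c v).1,
      (fun p => (p.1, p.2 * (splitData c v).1)) '' (splitData c u).2 ∪
      {((splitData c u).1, (splitData c v).1)} ∪
      (fun p => ((splitData c u).1 * p.1, p.2)) '' (splitData c v).2) := by
  refine Prod.ext rfl (Set.ext fun p => ⟨?_, ?_⟩)
  · rintro ⟨a, b, h, rfl⟩
    rcases FreeSemigroup.mul_eq_mul_iff.1 h with ⟨k, rfl, rfl⟩ | ⟨rfl, rfl⟩ | ⟨k, rfl, rfl⟩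
    · exact Or.inl (Or.inl ⟨_, ⟨a, k, rfl, rfl⟩, rfl⟩)
    · exact Or.inl (Or.inr rfl)
    · exact Or.inr ⟨_, ⟨k, b, rfl, rfl⟩, rfl⟩
  · rintro ((⟨_, ⟨a, b, rfl, rfl⟩, rfl⟩ | rfl) | ⟨_, ⟨a, b, rfl, rfl⟩, rfl⟩)
    · exact ⟨a, b * v, mul_assoc _ _ _, rfl⟩
    · exact ⟨u, v, rfl, rfl⟩
    · exact ⟨u * a, b, (mul_assoc _ _ _).symm, rfl⟩

/-- Two words are congruent if they are congruent modulo `c` and have the same factorisations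
modulo `c`. -/
def splitCon (c : FiniteCon A) : FiniteCon A :=
  ⟨{ r := fun u v => splitData c u = splitData c v
     iseqv := ⟨fun _ => rfl, fun h => h.symm, fun h h' => h.trans h'⟩
     mul' := by
       intro u u' v v' h h'
       rw [splitData_mul, splitData_mul, h, h'] },
   Con.finite_quotient_of_map _ (splitData c) fun _ _ h => h⟩

end FiniteCon

namespace FreeProfiniteSemigroup

variable {A : Type*}

instance : T2Space (FreeProfiniteSemigroup A) := inferInstanceAs (T2Space (Subtype _))

instance : TotallyDisconnectedSpace (FreeProfiniteSemigroup A) :=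
  inferInstanceAs (TotallyDisconnectedSpace (Subtype _))

instance : ContinuousMul (FreeProfiniteSemigroup A) :=
  ⟨Continuous.subtype_mk (continuous_pi fun c : FiniteCon A =>
    (continuous_of_discreteTopology (f := fun p : c.1.Quotient × c.1.Quotient => p.1 * p.2)).comp
      (((continuous_apply c).comp (continuous_subtype_val.comp continuous_fst)).prodMk
        ((continuous_apply c).comp (continuous_subtype_val.comp continuous_snd)))) _⟩

theorem continuous_coord (c : FiniteCon A) : Continuous fun x : FreeProfiniteSemigroup A => x.1 c :=
  (continuous_apply c).comp continuous_subtype_val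

theorem isOpen_coord (c : FiniteCon A) (z : c.1.Quotient) :
    IsOpen {x : FreeProfiniteSemigroup A | x.1 c = z} :=
  (isOpen_discrete {z}).preimage (continuous_coord c)

theorem exists_coord_eq (x : FreeProfiniteSemigroup A) (c : FiniteCon A) :
    ∃ w : FreeSemigroup A, x.1 c = (w : c.1.Quotient) := by
  obtain ⟨w, hw⟩ := Quotient.exists_rep (x.1 c)
  exact ⟨w, hw.symm⟩

theorem ofWord_mul (u v : FreeSemigroup A) : ofWord (u * v) = ofWord u * ofWord v := rfl

/-- A basic open set involves finitely many congruences, and these have a common refinement of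
finite index, so one coordinate at a time suffices. -/
theorem mem_closure_iff_coord {R : Set (FreeProfiniteSemigroup A)} {x : FreeProfiniteSemigroup A} :
    x ∈ closure R ↔ ∀ c : FiniteCon A, ∃ y ∈ R, x.1 c = y.1 c := by
  constructor
  · intro hx c
    obtain ⟨y, h1, hy⟩ := mem_closure_iff.1 hx _ (isOpen_coord c (x.1 c)) rfl
    exact ⟨y, hy, h1.symm⟩
  · intro h
    refine mem_closure_iff.2 ?_
    rintro U ⟨s, hs, rfl⟩ hx
    obtain ⟨I, t, h1, h2⟩ := isOpen_pi_iff.1 hs x.1 hx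
    obtain ⟨d, hd⟩ := FiniteCon.exists_le I
    obtain ⟨y, hy, hxy⟩ := h d
    refine ⟨y, h2 fun c hc => ?_, hy⟩
    obtain ⟨w, hw⟩ := exists_coord_eq x d
    have h3 : x.1 c = y.1 c :=
      (x.2 d c (hd c hc) w hw).trans (y.2 d c (hd c hc) w (hxy.symm.trans hw)).symm
    have h4 := (h1 c hc).2
    rwa [h3] at h4

theorem mem_closure_words_iff {K : Set (FreeSemigroup A)} {x : FreeProfiniteSemigroup A} :
    x ∈ closure (ofWord '' K) ↔ ∀ c : FiniteCon A, ∃ w ∈ K, x.1 c = (w : c.1.Quotient) := by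
  simp only [mem_closure_iff_coord, Set.exists_mem_image]
  rfl

/-- Modulo any congruence of finite index, a factorisation of a limit of words of `K` is the
factorisation of a word of `K`. -/
theorem exists_split {K : Set (FreeSemigroup A)} {x y : FreeProfiniteSemigroup A}
    (h : x * y ∈ closure (ofWord '' K)) (c : FiniteCon A) :
    ∃ u v : FreeSemigroup A, u * v ∈ K ∧ x.1 c = (u : c.1.Quotient) ∧
      y.1 c = (v : c.1.Quotient) := by
  obtain ⟨w, hw, h1⟩ := mem_closure_words_iff.1 h (FiniteCon.splitCon c)
  obtain ⟨u, hu⟩ := exists_coord_eq x (FiniteCon.splitCon c)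
  obtain ⟨v, hv⟩ := exists_coord_eq y (FiniteCon.splitCon c)
  have hle : (FiniteCon.splitCon c).1 ≤ c.1 := fun {a b} hab =>
    (Con.eq c.1).1 (congrArg Prod.fst (hab : FiniteCon.splitData c a = FiniteCon.splitData c b))
  have h2 : (x * y).1 (FiniteCon.splitCon c) =
      ((u * v : FreeSemigroup A) : (FiniteCon.splitCon c).1.Quotient) := by
    rw [Con.coe_mul, ← hu, ← hv]
    rfl
  have h3 : FiniteCon.splitData c (u * v) = FiniteCon.splitData c w :=
    (Con.eq _).1 (h2.symm.trans h1)
  -- The word w of K has the same factorisations modulo c as uv, so w itself factors with factors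
  -- congruent to u and v.
  have h4 : ((u : c.1.Quotient), (v : c.1.Quotient)) ∈ (FiniteCon.splitData c w).2 := by
    rw [← h3]
    exact ⟨u, v, rfl, rfl⟩
  obtain ⟨a, b, rfl, h5⟩ := h4
  exact ⟨a, b, hw, (x.2 _ _ hle u hu).trans (congrArg Prod.fst h5),
    (y.2 _ _ hle v hv).trans (congrArg Prod.snd h5)⟩

theorem left_mem_closure {K : Set (FreeSemigroup A)} {x y : FreeProfiniteSemigroup A}
    (h : x * y ∈ closure (ofWord '' K)) : x ∈ closure (ofWord '' {u | ∃ v, u * v ∈ K}) :=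
  mem_closure_words_iff.2 fun c => by
    obtain ⟨u, v, h1, h2, -⟩ := exists_split h c
    exact ⟨u, ⟨v, h1⟩, h2⟩

theorem right_mem_closure {K : Set (FreeSemigroup A)} {x y : FreeProfiniteSemigroup A}
    (h : x * y ∈ closure (ofWord '' K)) : y ∈ closure (ofWord '' {v | ∃ u, u * v ∈ K}) :=
  mem_closure_words_iff.2 fun c => by
    obtain ⟨u, v, h1, -, h2⟩ := exists_split h c
    exact ⟨v, ⟨u, h1⟩, h2⟩

section Finite

variable [Finite A]

/-- The prefix is one letter longer than w, which excludes proper extensions of w. Consequently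
words are isolated points. -/
theorem eq_of_prefixCon {v w : FreeSemigroup A}
    (h : (FiniteCon.prefixCon (w.toWord.length + 1)).1 v w) : v = w := by
  have h1 : v.toWord.take (w.toWord.length + 1) = w.toWord.take (w.toWord.length + 1) := h
  rw [List.take_of_length_le (Nat.le_succ _)] at h1
  have h2 := congrArg List.length h1
  rw [List.length_take] at h2
  rw [List.take_of_length_le (by omega)] at h1
  exact FreeSemigroup.toWord_injective h1

theorem ofWord_mem_closure_iff {K : Set (FreeSemigroup A)} {w : FreeSemigroup A} :
    ofWord w ∈ closure (ofWord '' K) ↔ w ∈ K := by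
  refine ⟨fun h => ?_, fun h => subset_closure ⟨w, h, rfl⟩⟩
  obtain ⟨v, hv, h1⟩ := mem_closure_words_iff.1 h (FiniteCon.prefixCon (w.toWord.length + 1))
  rwa [← eq_of_prefixCon ((Con.eq _).1 h1.symm)]

/-- Factors of w in the profinite semigroup are limits of factors of w in A⁺, of which there are
finitely many. So the elements that are not words form an ideal. -/
theorem mem_range_of_mul_mem_range {x y : FreeProfiniteSemigroup A}
    (h : x * y ∈ Set.range (ofWord (A := A))) :
    x ∈ Set.range (ofWord (A := A)) ∧ y ∈ Set.range (ofWord (A := A)) := by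
  obtain ⟨w, hw⟩ := h
  have h1 : x * y ∈ closure (ofWord '' {w}) := by
    rw [← hw]
    exact subset_closure ⟨w, rfl, rfl⟩
  have hlen : ∀ u v : FreeSemigroup A, u * v = w →
      u.toWord.length ≤ w.toWord.length ∧ v.toWord.length ≤ w.toWord.length := by
    rintro u v rfl
    simp [FreeSemigroup.toWord_mul]
  have hfin : ∀ K : Set (FreeSemigroup A), K ⊆ {u | u.toWord.length ≤ w.toWord.length} →
      closure (ofWord '' K) ⊆ Set.range (ofWord (A := A)) := fun K hK => by
    rw [(((FreeSemigroup.finite_toWord_length_le _).subset hK).image _).isClosed.closure_eq]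
    exact Set.image_subset_range _ _
  refine ⟨hfin _ ?_ (left_mem_closure h1), hfin _ ?_ (right_mem_closure h1)⟩
  · exact fun u ⟨v, h⟩ => (hlen u v h).1
  · exact fun v ⟨u, h⟩ => (hlen u v h).2

/-- An element outside the set of words is a limit of arbitrarily long words. -/
theorem mem_closure_long {K : Set (FreeSemigroup A)} {x : FreeProfiniteSemigroup A}
    (hx : x ∈ closure (ofWord '' K)) (hx' : x ∉ Set.range (ofWord (A := A))) (n : ℕ) :
    x ∈ closure (ofWord '' {w ∈ K | n ≤ w.toWord.length}) := by
  have h1 : K ⊆ {w ∈ K | n ≤ w.toWord.length} ∪ {w | w.toWord.length ≤ n} := fun w hw =>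
    (le_total n w.toWord.length).imp (fun h => ⟨hw, h⟩) id
  have h2 := closure_mono (Set.image_mono h1) hx
  rw [Set.image_union, closure_union,
    ((FreeSemigroup.finite_toWord_length_le n).image _).isClosed.closure_eq] at h2
  exact h2.resolve_right fun ⟨w, _, hw⟩ => hx' ⟨w, hw⟩

theorem notMem_range_of_long {K : Set (FreeSemigroup A)} {x : FreeProfiniteSemigroup A}
    (h : ∀ n, x ∈ closure (ofWord '' {w ∈ K | n ≤ w.toWord.length})) :
    x ∉ Set.range (ofWord (A := A)) := by
  rintro ⟨w, rfl⟩
  have := (ofWord_mem_closure_iff.1 (h (w.toWord.length + 1))).2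
  omega

end Finite

end FreeProfiniteSemigroup

/-! ### Stability of compact semigroups -/

section CompactSemigroup

variable {S : Type*} [Semigroup S] [TopologicalSpace S] [CompactSpace S] [T2Space S]
  [ContinuousMul S]

/-- Compact semigroups are stable, right version. -/
theorem exists_eq_mul_right {s x y : S} (h : x = s * x * y) : ∃ t, x = x * y * t := by
  -- T consists of the right multiples f of y for which x = a x f for some a. It is a compact
  -- subsemigroup; an idempotent f = yt in it satisfies xf = x, so x = xyt.
  let T : Set S := Set.range (y * ·) ∩ Prod.snd '' {p : S × S | x = p.1 * x * p.2}
  have hT : IsCompact T := by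
    refine (isCompact_range (continuous_const_mul y)).inter_right
      (IsCompact.isClosed (IsCompact.image (IsClosed.isCompact ?_) continuous_snd))
    exact isClosed_eq continuous_const (by fun_prop)
  obtain ⟨f, ⟨⟨t, ht⟩, ⟨s', f'⟩, hs', rfl⟩, hf⟩ := exists_idempotent_in_compact_subsemigroup
    (fun r => continuous_mul_const r) T
    -- The square is used because y itself need not be a right multiple of y.
    ⟨y * y, ⟨y, rfl⟩, (s * s, y * y), by
      change x = s * s * x * (y * y)
      calc x = s * x * y := h
        _ = s * (s * x * y) * y := congrArg (fun z => s * z * y) h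
        _ = _ := by simp only [mul_assoc], rfl⟩ hT
    (by
      rintro _ ⟨⟨t, rfl⟩, ⟨a, _⟩, ha, rfl⟩ _ ⟨-, ⟨b, g⟩, hb, rfl⟩
      refine ⟨⟨t * g, (mul_assoc _ _ _).symm⟩, (b * a, _), ?_, rfl⟩
      simp only [Set.mem_ofPred_eq] at ha hb ⊢
      calc x = b * x * g := hb
        _ = b * (a * x * (y * t)) * g := by rw [← ha]
        _ = _ := by simp only [mul_assoc])
  simp only [Set.mem_ofPred_eq] at hs' hf ht
  refine ⟨t, ?_⟩
  have h1 : x * f' = x := by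
    calc x * f' = s' * x * f' * f' := by rw [← hs']
      _ = s' * x * (f' * f') := mul_assoc _ _ _
      _ = x := by rw [hf, ← hs']
  rw [mul_assoc, ht, h1]

/-- Compact semigroups are stable, left version. -/
theorem exists_eq_mul_left {s x y : S} (h : x = s * x * y) : ∃ t, x = t * (s * x) := by
  obtain ⟨t, ht⟩ := exists_eq_mul_right (s := MulOpposite.op y) (x := MulOpposite.op x)
    (y := MulOpposite.op s) (by
      rw [← MulOpposite.op_mul, ← MulOpposite.op_mul, ← mul_assoc, ← h])
  exact ⟨t.unop, congrArg MulOpposite.unop ht⟩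

end CompactSemigroup

open FreeProfiniteSemigroup

/-! ### Divisibility in J(φ) -/

namespace Substitution

variable {A : Type*} {φ : Substitution A}

theorem mem_language_of_mul_left {u v : FreeSemigroup A} (h : u * v ∈ φ.language) :
    u ∈ φ.language :=
  (mem_language_iff φ).2 (ListSubst.lang_infix ((mem_language_iff φ).1 h)
    (List.prefix_append u.toWord v.toWord).isInfix)

theorem mem_language_of_mul_right {u v : FreeSemigroup A} (h : u * v ∈ φ.language) :
    v ∈ φ.language :=
  (mem_language_iff φ).2 (ListSubst.lang_infix ((mem_language_iff φ).1 h)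
    (List.suffix_append u.toWord v.toWord).isInfix)

theorem apply_mem_language {w : FreeSemigroup A} (h : w ∈ φ.language) : φ w ∈ φ.language := by
  rw [mem_language_iff, toWord_apply]
  exact ListSubst.map_mem_lang ((mem_language_iff φ).1 h)

variable {x y : FreeProfiniteSemigroup A}

theorem left_mem_closure_language (h : x * y ∈ closure (ofWord '' φ.language)) :
    x ∈ closure (ofWord '' φ.language) :=
  closure_mono (Set.image_mono (by rintro _ ⟨_, h⟩; exact mem_language_of_mul_left h))
    (left_mem_closure h)

theorem right_mem_closure_language (h : x * y ∈ closure (ofWord '' φ.language)) :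
    y ∈ closure (ofWord '' φ.language) :=
  closure_mono (Set.image_mono (by rintro _ ⟨_, h⟩; exact mem_language_of_mul_right h))
    (right_mem_closure h)

variable [Finite A]

theorem mem_jClass_iff : x ∈ φ.jClass ↔
    x ∈ closure (ofWord '' φ.language) ∧ x ∉ Set.range (ofWord (A := A)) := by
  refine and_congr_right fun h => not_congr ⟨fun ⟨w, _, hw⟩ => ⟨w, hw⟩, ?_⟩
  rintro ⟨w, rfl⟩
  exact ⟨w, ofWord_mem_closure_iff.1 h, rfl⟩

/-- Words of bounded length are finitely many and isolated, so they do not affect limits outside A⁺.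
In this form J(φ) is visibly closed and contains limits of words of the language with lengths
tending to infinity. -/
theorem mem_jClass_iff_long : x ∈ φ.jClass ↔
    ∀ n, x ∈ closure (ofWord '' {w ∈ φ.language | n ≤ w.toWord.length}) :=
  mem_jClass_iff.trans ⟨fun h => mem_closure_long h.1 h.2, fun h =>
    ⟨closure_mono (Set.image_mono fun _ h => h.1) (h 0), notMem_range_of_long h⟩⟩

theorem isClosed_jClass : IsClosed φ.jClass := by
  have : φ.jClass = ⋂ n, closure (ofWord '' {w ∈ φ.language | n ≤ w.toWord.length}) :=
    Set.ext fun x => mem_jClass_iff_long.trans Set.mem_iInter.symm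
  rw [this]
  exact isClosed_iInter fun _ => isClosed_closure

theorem jClass_of_mul_left (h : x * y ∈ φ.jClass) (hx : x ∉ Set.range (ofWord (A := A))) :
    x ∈ φ.jClass :=
  mem_jClass_iff.2 ⟨left_mem_closure_language (mem_jClass_iff.1 h).1, hx⟩

theorem jClass_of_mul_right (h : x * y ∈ φ.jClass) (hy : y ∉ Set.range (ofWord (A := A))) :
    y ∈ φ.jClass :=
  mem_jClass_iff.2 ⟨right_mem_closure_language (mem_jClass_iff.1 h).1, hy⟩

theorem notMem_range_of_mem_jClass (h : x ∈ φ.jClass) : x ∉ Set.range (ofWord (A := A)) :=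
  (mem_jClass_iff.1 h).2

theorem mem_jClass_of_mul_mul_left {z : FreeProfiniteSemigroup A} (hx : x ∈ φ.jClass)
    (h : x * y * z ∈ φ.jClass) : x * y ∈ φ.jClass :=
  jClass_of_mul_left h fun h' => notMem_range_of_mem_jClass hx (mem_range_of_mul_mem_range h').1

theorem mem_jClass_of_mul_mul_right {z : FreeProfiniteSemigroup A} (hx : x ∈ φ.jClass)
    (h : z * (y * x) ∈ φ.jClass) : y * x ∈ φ.jClass :=
  jClass_of_mul_right h fun h' => notMem_range_of_mem_jClass hx (mem_range_of_mul_mem_range h').2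

theorem extend_mem_jClass (h : x ∈ φ.jClass) : extend φ x ∈ φ.jClass := by
  refine mem_jClass_iff_long.2 fun n => ?_
  refine map_mem_closure (continuous_extend φ) (mem_jClass_iff_long.1 h n) ?_
  rintro _ ⟨w, ⟨hw, hn⟩, rfl⟩
  exact ⟨φ w, ⟨apply_mem_language hw, hn.trans (length_iterate_letters 1 w)⟩, rfl⟩

/-- Possessing a factorisation of a given shape is a closed condition, by compactness, so it passes
from long words to their limits. The same argument serves the next lemmas. -/
theorem exists_letter_mul (h : x ∈ φ.jClass) :
    ∃ a, ∃ x' ∈ φ.jClass, x = ofWord (FreeSemigroup.of a) * x' := by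
  have h1 : closure (ofWord '' {w ∈ φ.language | 2 ≤ w.toWord.length}) ⊆
      ⋃ a, Set.range (ofWord (FreeSemigroup.of a) * ·) := by
    refine closure_minimal ?_ (isClosed_iUnion_of_finite fun a =>
      (isCompact_range (continuous_const_mul _)).isClosed)
    rintro _ ⟨⟨a, l⟩, ⟨-, hw⟩, rfl⟩
    cases l with
    | nil => exact absurd hw (by simp [FreeSemigroup.toWord])
    | cons b l => exact Set.mem_iUnion.2 ⟨a, ofWord ⟨b, l⟩, rfl⟩
  obtain ⟨a, x', rfl⟩ := Set.mem_iUnion.1 (h1 (mem_jClass_iff_long.1 h 2))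
  refine ⟨a, x', jClass_of_mul_right h ?_, rfl⟩
  rintro ⟨w, rfl⟩
  exact notMem_range_of_mem_jClass h ⟨_, rfl⟩

theorem exists_mul_letter (h : x ∈ φ.jClass) :
    ∃ a, ∃ x' ∈ φ.jClass, x = x' * ofWord (FreeSemigroup.of a) := by
  have h1 : closure (ofWord '' {w ∈ φ.language | 2 ≤ w.toWord.length}) ⊆
      ⋃ a, Set.range (· * ofWord (FreeSemigroup.of a)) := by
    refine closure_minimal ?_ (isClosed_iUnion_of_finite fun a =>
      (isCompact_range (continuous_mul_const _)).isClosed)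
    rintro _ ⟨w, ⟨-, hw⟩, rfl⟩
    rcases List.eq_nil_or_concat w.toWord with h | ⟨l, a, h⟩
    · exact absurd h w.toWord_ne_nil
    · rw [List.concat_eq_append] at h
      rw [h, List.length_append, List.length_singleton] at hw
      obtain ⟨u, rfl⟩ := FreeSemigroup.exists_toWord_eq (List.length_pos_iff.1 (by omega : 0 < l.length))
      obtain rfl : w = u * FreeSemigroup.of a := FreeSemigroup.toWord_injective h
      exact Set.mem_iUnion.2 ⟨a, ofWord u, rfl⟩
  obtain ⟨a, x', rfl⟩ := Set.mem_iUnion.1 (h1 (mem_jClass_iff_long.1 h 2))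
  refine ⟨a, x', jClass_of_mul_left h ?_, rfl⟩
  rintro ⟨w, rfl⟩
  exact notMem_range_of_mem_jClass h ⟨_, rfl⟩

theorem exists_eq_mul_ofWord_mul (hp : φ.WeaklyPrimitive) {w : FreeSemigroup A}
    (hw : w ∈ φ.language) (hy : y ∈ φ.jClass) : ∃ s t, y = s * ofWord w * t := by
  obtain ⟨n, hn⟩ := hp.exists_letters
  obtain ⟨N, hN⟩ := hn.recurrent_interior ((mem_language_iff φ).1 hw)
  have h1 : closure (ofWord '' {w ∈ φ.language | N ≤ w.toWord.length}) ⊆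
      Set.range fun p : FreeProfiniteSemigroup A × FreeProfiniteSemigroup A =>
        p.1 * ofWord w * p.2 := by
    refine closure_minimal ?_ (isCompact_range (by fun_prop)).isClosed
    rintro _ ⟨v, ⟨hv, hvN⟩, rfl⟩
    obtain ⟨s, t, hs, ht, h⟩ := hN v.toWord ((mem_language_iff φ).1 hv) hvN
    obtain ⟨s, rfl⟩ := FreeSemigroup.exists_toWord_eq hs
    obtain ⟨t, rfl⟩ := FreeSemigroup.exists_toWord_eq ht
    obtain rfl : v = s * w * t := FreeSemigroup.toWord_injective h
    exact ⟨(ofWord s, ofWord t), rfl⟩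
  obtain ⟨⟨s, t⟩, h⟩ := h1 (mem_jClass_iff_long.1 hy N)
  exact ⟨s, t, h.symm⟩

/-- Any two elements of `J(φ)` are factors of each other. -/
theorem exists_eq_mul_mul (hp : φ.WeaklyPrimitive) (hx : x ∈ φ.jClass) (hy : y ∈ φ.jClass) :
    ∃ s t, y = s * x * t := by
  have h1 : closure (ofWord '' φ.language) ⊆ (fun p : FreeProfiniteSemigroup A ×
      FreeProfiniteSemigroup A × FreeProfiniteSemigroup A => p.1) '' {p | y = p.2.1 * p.1 * p.2.2} := by
    refine closure_minimal ?_ (IsCompact.isClosed (IsCompact.image (IsClosed.isCompact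
      (isClosed_eq continuous_const (by fun_prop))) (by fun_prop)))
    rintro _ ⟨w, hw, rfl⟩
    obtain ⟨s, t, h⟩ := exists_eq_mul_ofWord_mul hp hw hy
    exact ⟨(ofWord w, s, t), h, rfl⟩
  obtain ⟨⟨_, s, t⟩, h, rfl⟩ := h1 hx.1
  exact ⟨s, t, h⟩

/-- Since x and xy are both in J(φ), they divide each other on both sides; stability turns this into
divisibility on the right. -/
theorem exists_eq_mul_right_of_mem (hp : φ.WeaklyPrimitive) (hx : x ∈ φ.jClass)
    (h : x * y ∈ φ.jClass) : ∃ t, x = x * y * t := by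
  obtain ⟨s, t, h1⟩ := exists_eq_mul_mul hp h hx
  obtain ⟨r, hr⟩ := exists_eq_mul_right (s := s) (x := x) (y := y * t) (by
    simpa only [mul_assoc] using h1)
  exact ⟨t * r, by simpa only [mul_assoc] using hr⟩

theorem exists_eq_mul_left_of_mem (hp : φ.WeaklyPrimitive) (hy : y ∈ φ.jClass)
    (h : x * y ∈ φ.jClass) : ∃ t, y = t * (x * y) := by
  obtain ⟨s, t, h1⟩ := exists_eq_mul_mul hp h hy
  obtain ⟨r, hr⟩ := exists_eq_mul_left (s := s * x) (x := y) (y := t) (by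
    simpa only [mul_assoc] using h1)
  exact ⟨r * s, by simpa only [mul_assoc] using hr⟩

theorem language_subset_jFactors (hp : φ.WeaklyPrimitive) (hJ : φ.jClass.Nonempty) :
    φ.language ⊆ φ.jFactors := by
  intro w hw
  obtain ⟨y, hy⟩ := hJ
  obtain ⟨s, t, rfl⟩ := exists_eq_mul_ofWord_mul hp hw hy
  exact ⟨_, hy, s, t, rfl⟩

end Substitution

/-! ### Desubstitution at the junction of two images -/

namespace FreeProfiniteSemigroup

variable {A : Type*}

/-- Multiplication by a possibly empty word on the right. -/
def mulList (x : FreeProfiniteSemigroup A) (l : List A) : FreeProfiniteSemigroup A :=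
  l.foldl (fun y a => y * ofWord (FreeSemigroup.of a)) x

/-- Multiplication by a possibly empty word on the left. -/
def listMul (l : List A) (x : FreeProfiniteSemigroup A) : FreeProfiniteSemigroup A :=
  l.foldr (fun a y => ofWord (FreeSemigroup.of a) * y) x

theorem mulList_append (x : FreeProfiniteSemigroup A) (l l' : List A) :
    mulList x (l ++ l') = mulList (mulList x l) l' := List.foldl_append

theorem listMul_append (x : FreeProfiniteSemigroup A) (l l' : List A) :
    listMul (l ++ l') x = listMul l (listMul l' x) := List.foldr_append

theorem mulList_mul (l : List A) (x y : FreeProfiniteSemigroup A) :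
    mulList x l * y = x * listMul l y := by
  induction l generalizing x with
  | nil => rfl
  | cons a l ih =>
    change mulList (x * ofWord _) l * y = x * (ofWord _ * listMul l y)
    rw [ih, mul_assoc]

theorem listMul_toWord (w : FreeSemigroup A) (x : FreeProfiniteSemigroup A) :
    listMul w.toWord x = ofWord w * x := by
  induction w using FreeSemigroup.recOnMul generalizing x with
  | ih1 a => rfl
  | ih2 a w ha hw =>
    rw [FreeSemigroup.toWord_mul, listMul_append, hw, ha, ofWord_mul, mul_assoc]

theorem mulList_toWord (w : FreeSemigroup A) (x : FreeProfiniteSemigroup A) :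
    mulList x w.toWord = x * ofWord w := by
  induction w using FreeSemigroup.recOnMul generalizing x with
  | ih1 a => rfl
  | ih2 a w ha hw =>
    rw [FreeSemigroup.toWord_mul, mulList_append, hw, ha, ofWord_mul, mul_assoc]

theorem continuous_mulList (l : List A) :
    Continuous fun x : FreeProfiniteSemigroup A => mulList x l := by
  induction l with
  | nil => exact continuous_id
  | cons a l ih => exact ih.comp (continuous_mul_const _)

theorem continuous_listMul (l : List A) :
    Continuous fun x : FreeProfiniteSemigroup A => listMul l x := by
  induction l with
  | nil => exact continuous_id
  | cons a l ih => exact (continuous_const_mul _).comp ih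

theorem extend_mulList (φ : Substitution A) (x : FreeProfiniteSemigroup A) (l : List A) :
    extend φ (mulList x l) = mulList (extend φ x) (ListSubst.map φ.letters l) := by
  induction l generalizing x with
  | nil => rfl
  | cons a l ih =>
    rw [ListSubst.map_cons, mulList_append, Substitution.letters, mulList_toWord]
    exact (ih _).trans (by rw [map_mul, extend_ofWord])

theorem extend_listMul (φ : Substitution A) (x : FreeProfiniteSemigroup A) (l : List A) :
    extend φ (listMul l x) = listMul (ListSubst.map φ.letters l) (extend φ x) := by
  induction l with
  | nil => rfl
  | cons a l ih =>
    rw [ListSubst.map_cons, listMul_append, Substitution.letters, listMul_toWord, ← ih,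
      ← extend_ofWord, ← map_mul]
    rfl

theorem exists_tendsto_ultrafilter {ι : Type*} (U : Ultrafilter ι)
    (f : ι → FreeProfiniteSemigroup A) : ∃ x, Tendsto f U (𝓝 x) := by
  obtain ⟨x, -, hx⟩ := isCompact_univ.ultrafilter_le_nhds (U.map f) (by simp)
  exact ⟨x, hx⟩

end FreeProfiniteSemigroup

theorem Ultrafilter.exists_eventually_eq_of_finite {ι T : Type*} (U : Ultrafilter ι) {K : Set T}
    (hK : K.Finite) {f : ι → T} (hf : ∀ i, f i ∈ K) : ∃ t, ∀ᶠ i in U, f i = t := by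
  have h : (⋃ t ∈ K, {i | f i = t}) ∈ U := by
    refine Filter.mem_of_superset Filter.univ_mem fun i _ => ?_
    exact Set.mem_biUnion (t := fun t => {i | f i = t}) (hf i) (rfl : f i = f i)
  obtain ⟨t, -, ht⟩ := (Ultrafilter.finite_biUnion_mem_iff hK).1 h
  exact ⟨t, ht⟩

open FreeProfiniteSemigroup

namespace Substitution

variable {A : Type*} {φ : Substitution A} [Finite A] {x z : FreeProfiniteSemigroup A}

theorem exists_mulList_eq (hx : x ∈ φ.jClass) (n : ℕ) :
    ∃ x' ∈ φ.jClass, ∃ l : List A, l.length = n ∧ x = mulList x' l := by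
  induction n with
  | zero => exact ⟨x, hx, [], rfl, rfl⟩
  | succ n ih =>
    obtain ⟨x', hx', l, hl, h⟩ := ih
    obtain ⟨a, y, hy, rfl⟩ := exists_mul_letter hx'
    exact ⟨y, hy, a :: l, by simp [hl], h⟩

theorem exists_listMul_eq (hx : x ∈ φ.jClass) (n : ℕ) :
    ∃ x' ∈ φ.jClass, ∃ l : List A, l.length = n ∧ x = listMul l x' := by
  induction n with
  | zero => exact ⟨x, hx, [], rfl, rfl⟩
  | succ n ih =>
    obtain ⟨x', hx', l, hl, h⟩ := ih
    obtain ⟨a, y, hy, rfl⟩ := exists_letter_mul hx'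
    exact ⟨y, hy, l ++ [a], by simp [hl], by rw [h, listMul_append]; rfl⟩

theorem mem_language_of_factor {w : FreeSemigroup A} (h : x * ofWord w * z ∈ φ.jClass) :
    w ∈ φ.language :=
  ofWord_mem_closure_iff.1 (right_mem_closure_language (left_mem_closure_language h.1))

/-- The words near the junction of two elements of `J(φ)` whose images are multiplied. -/
theorem exists_junction_words (hinj : Function.Injective φ)
    {N : ℕ} (hd : ListSubst.Delay φ.letters N)
    (hpre : ∀ w ∈ ListSubst.lang φ.letters,
      ∃ v ∈ ListSubst.lang φ.letters, w <:+: ListSubst.map φ.letters v)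
    (s : FreeSemigroup A) : ∃ D, ∀ x ∈ φ.jClass, ∀ z ∈ φ.jClass,
    extend φ x * ofWord s * extend φ z ∈ φ.jClass → ∀ n : ℕ,
    ∃ (c d : FreeProfiniteSemigroup A) (a b m : FreeSemigroup A) (p q : List A),
      p.length ≤ D ∧ q.length ≤ D ∧ x = mulList (c * ofWord a) p ∧ z = listMul q (ofWord b * d) ∧
      (φ m).toWord = ListSubst.map φ.letters p ++ s.toWord ++ ListSubst.map φ.letters q ∧
      a * m * b ∈ φ.language ∧ n ≤ a.toWord.length ∧ n ≤ b.toWord.length := by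
  obtain ⟨M, hM⟩ := (Set.finite_range fun c => (φ.letters c).length).bddAbove
  have hM' : ∀ c, (φ.letters c).length ≤ M := fun c => hM ⟨c, rfl⟩
  refine ⟨N + M + 1, fun x hx z hz h n => ?_⟩
  set D := N + M + 1 with hD
  -- The blocks p₁, p₃, q₁, q₃ have the length required for synchronisation. The middle blocks p₂
  -- and q₂ make a and b long, while the leftovers p and q stay within p₃ and q₁ and are bounded by
  -- D whatever n is.
  obtain ⟨x₃, hx₃, p₃, hp₃, h1⟩ := exists_mulList_eq hx D
  obtain ⟨x₂, hx₂, p₂, hp₂, rfl⟩ := exists_mulList_eq hx₃ (n + 1)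
  obtain ⟨x₁, hx₁, p₁, hp₁, rfl⟩ := exists_mulList_eq hx₂ D
  obtain ⟨z₁, hz₁, q₁, hq₁, h2⟩ := exists_listMul_eq hz D
  obtain ⟨z₂, hz₂, q₂, hq₂, rfl⟩ := exists_listMul_eq hz₁ (n + 1)
  obtain ⟨z₃, hz₃, q₃, hq₃, rfl⟩ := exists_listMul_eq hz₂ D
  rw [← mulList_append, ← mulList_append] at h1
  rw [← listMul_append, ← listMul_append] at h2
  have h3 : ListSubst.map φ.letters (p₁ ++ p₂ ++ p₃) ++ s.toWord ++
      ListSubst.map φ.letters (q₁ ++ q₂ ++ q₃) ∈ ListSubst.lang φ.letters := by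
    obtain ⟨w, hw⟩ := FreeSemigroup.exists_toWord_eq
      (l := ListSubst.map φ.letters (p₁ ++ p₂ ++ p₃) ++ s.toWord ++
        ListSubst.map φ.letters (q₁ ++ q₂ ++ q₃)) (by simp [s.toWord_ne_nil])
    rw [← hw, ← mem_language_iff]
    refine mem_language_of_factor (x := extend φ x₁) (z := extend φ z₃) ?_
    rw [mul_assoc, ← listMul_toWord, hw, listMul_append, listMul_append, ← mulList_mul,
      ← extend_mulList, ← extend_listMul, listMul_toWord, ← mul_assoc, List.append_assoc p₁,
      ← h1, ← h2]
    exact h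
  obtain ⟨p₃', p₃'', q₁', q₁'', m, rfl, rfl, h4, h5⟩ := hd.junction φ.letters_ne_nil hM'
    (map_letters_injective φ hinj) hpre (by omega : N + M < D) hp₁ hp₃ hq₁ hq₃ h3
  obtain ⟨a, ha⟩ := FreeSemigroup.exists_toWord_eq (l := p₂ ++ p₃') (by
    rw [← List.length_pos_iff, List.length_append]; omega)
  obtain ⟨b, hb⟩ := FreeSemigroup.exists_toWord_eq (l := q₁'' ++ q₂) (by
    rw [← List.length_pos_iff, List.length_append]; omega)
  -- The list m is nonempty because its image contains the nonempty word s.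
  obtain ⟨m, rfl⟩ := FreeSemigroup.exists_toWord_eq (l := m) (by
    rintro rfl
    have := congrArg List.length h4
    have h6 := List.length_pos_iff.2 s.toWord_ne_nil
    simp only [ListSubst.map_nil, List.length_nil, List.length_append] at this
    omega)
  have ha' := congrArg List.length ha
  have hb' := congrArg List.length hb
  rw [List.length_append] at ha' hb' hp₃ hq₁
  refine ⟨mulList x₁ p₁, listMul q₃ z₃, a, b, m, p₃'', q₁', by omega, by omega, ?_, ?_, ?_, ?_,
    by omega, by omega⟩
  · rw [← mulList_toWord, ha, ← mulList_append, ← mulList_append, h1]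
    simp only [List.append_assoc]
  · rw [← listMul_toWord, hb, ← listMul_append, ← listMul_append, h2]
    simp only [List.append_assoc]
  · rw [toWord_apply, h4]
  · rw [mem_language_iff, FreeSemigroup.toWord_mul, FreeSemigroup.toWord_mul, ha, hb]
    simpa only [List.append_assoc] using h5

/-- If the images of two elements of `J(φ)`, separated by a word, form an element of `J(φ)`, then
this is the image of an element of `J(φ)`. -/
theorem exists_junction (hp : φ.WeaklyPrimitive) (hinj : Function.Injective φ)
    {N : ℕ} (hd : ListSubst.Delay φ.letters N)
    (hpre : ∀ w ∈ ListSubst.lang φ.letters,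
      ∃ v ∈ ListSubst.lang φ.letters, w <:+: ListSubst.map φ.letters v)
    (s : FreeSemigroup A) (hx : x ∈ φ.jClass) (hz : z ∈ φ.jClass)
    (h : extend φ x * ofWord s * extend φ z ∈ φ.jClass) :
    ∃ y ∈ φ.jClass, extend φ y = extend φ x * ofWord s * extend φ z ∧
      (∃ t, y = x * t) ∧ ∃ t, y = t * z := by
  obtain ⟨D, hD⟩ := exists_junction_words hinj hd hpre s
  choose c d a b m p q h1 h2 h3 h4 h5 h6 h7 h8 using hD x hx z hz h
  -- Along a nonprincipal ultrafilter the bounded lists p and q become constant. So does the image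
  -- of m, and m itself by injectivity; the other ingredients converge by compactness.
  let U : Ultrafilter ℕ := hyperfilter ℕ
  have hU : (U : Filter ℕ) ≤ atTop := Nat.hyperfilter_le_atTop
  obtain ⟨P, hP⟩ := U.exists_eventually_eq_of_finite (List.finite_length_le A D) h1
  obtain ⟨Q, hQ⟩ := U.exists_eventually_eq_of_finite (List.finite_length_le A D) h2
  obtain ⟨k, hk⟩ := (hP.and hQ).exists
  have hm : ∀ᶠ n in (U : Filter ℕ), m n = m k := by
    filter_upwards [hP, hQ] with n hn hn'
    refine hinj (FreeSemigroup.toWord_injective ?_)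
    rw [h5, h5, hn, hn', hk.1, hk.2]
  obtain ⟨α, hα⟩ := exists_tendsto_ultrafilter U fun n => ofWord (a n)
  obtain ⟨β, hβ⟩ := exists_tendsto_ultrafilter U fun n => ofWord (b n)
  obtain ⟨γ, hγ⟩ := exists_tendsto_ultrafilter U c
  obtain ⟨δ, hδ⟩ := exists_tendsto_ultrafilter U d
  have hαJ : α ∈ φ.jClass := mem_jClass_iff_long.2 fun n => mem_closure_of_tendsto hα <| by
    filter_upwards [hU (eventually_ge_atTop n)] with i hi
    exact ⟨a i, ⟨mem_language_of_mul_left (mem_language_of_mul_left (h6 i)),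
      le_trans hi (h7 i)⟩, rfl⟩
  have hβJ : β ∈ φ.jClass := mem_jClass_iff_long.2 fun n => mem_closure_of_tendsto hβ <| by
    filter_upwards [hU (eventually_ge_atTop n)] with i hi
    exact ⟨b i, ⟨mem_language_of_mul_right (h6 i), le_trans hi (h8 i)⟩, rfl⟩
  have hαβ : α * ofWord (m k) * β ∈ φ.jClass := by
    refine mem_jClass_iff_long.2 fun n =>
      mem_closure_of_tendsto ((hα.mul tendsto_const_nhds).mul hβ) ?_
    filter_upwards [hU (eventually_ge_atTop n), hm] with i hi hi'
    refine ⟨a i * m i * b i, ⟨h6 i, ?_⟩, ?_⟩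
    · have := h7 i
      simp only [FreeSemigroup.toWord_mul, List.length_append]
      omega
    · rw [ofWord_mul, ofWord_mul, hi']
  have hxP : x = mulList (γ * α) P := by
    refine tendsto_nhds_unique (f := fun n => mulList (c n * ofWord (a n)) P) ?_
      (((continuous_mulList P).tendsto _).comp (hγ.mul hα)) (l := U)
    refine tendsto_const_nhds.congr' ?_
    filter_upwards [hP] with n hn
    rw [← hn, ← h3]
  have hzQ : z = listMul Q (β * δ) := by
    refine tendsto_nhds_unique (f := fun n => listMul Q (ofWord (b n) * d n)) ?_
      (((continuous_listMul Q).tendsto _).comp (hβ.mul hδ)) (l := U)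
    refine tendsto_const_nhds.congr' ?_
    filter_upwards [hQ] with n hn
    rw [← hn, ← h4]
  have hx' : γ * α ∈ φ.jClass := by
    have h9 : γ * α ∉ Set.range (ofWord (A := A)) := fun h =>
      notMem_range_of_mem_jClass hαJ (mem_range_of_mul_mem_range h).2
    rcases eq_or_ne P [] with rfl | hP0
    · rwa [hxP] at hx
    · obtain ⟨P, rfl⟩ := FreeSemigroup.exists_toWord_eq hP0
      rw [hxP, mulList_toWord] at hx
      exact jClass_of_mul_left hx h9
  have hz' : β * δ ∈ φ.jClass := by
    have h9 : β * δ ∉ Set.range (ofWord (A := A)) := fun h =>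
      notMem_range_of_mem_jClass hβJ (mem_range_of_mul_mem_range h).1
    rcases eq_or_ne Q [] with rfl | hQ0
    · rwa [hzQ] at hz
    · obtain ⟨Q, rfl⟩ := FreeSemigroup.exists_toWord_eq hQ0
      rw [hzQ, listMul_toWord] at hz
      exact jClass_of_mul_right hz h9
  -- The product α m β is in J(φ), so α is a right multiple of it. Multiplying by γ, one recovers γα
  -- from γα m β, which therefore stays in J(φ). The next step treats δ symmetrically.
  have hy1 : γ * α * (ofWord (m k) * β) ∈ φ.jClass := by
    rw [mul_assoc] at hαβ
    obtain ⟨t, ht⟩ := exists_eq_mul_right_of_mem hp hαJ hαβ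
    refine mem_jClass_of_mul_mul_left (z := t) hx' ?_
    rw [mul_assoc γ, mul_assoc γ, ← ht]
    exact hx'
  have hy2 : γ * α * ofWord (m k) * (β * δ) ∈ φ.jClass := by
    rw [← mul_assoc] at hy1
    obtain ⟨t, ht⟩ := exists_eq_mul_left_of_mem hp hβJ hy1
    refine mem_jClass_of_mul_mul_right (z := t) hz' ?_
    rw [← mul_assoc _ β, ← mul_assoc t, ← ht]
    exact hz'
  refine ⟨_, hy2, ?_, ?_, ?_⟩
  · have hmk := h5 k
    rw [hk.1, hk.2] at hmk
    rw [hxP, hzQ, extend_mulList, extend_listMul, map_mul, map_mul _ (γ * α), mul_assoc,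
      mul_assoc, mulList_mul, extend_ofWord, ← listMul_toWord, ← listMul_toWord s, hmk,
      listMul_append, listMul_append]
  -- As x = γα·P, stability makes γα a right multiple of x, and hence y too. The empty P is separate
  -- because it is not an element of the semigroup.
  · rcases eq_or_ne P [] with rfl | hP0
    · exact ⟨ofWord (m k) * (β * δ), by rw [hxP, mul_assoc]; rfl⟩
    · obtain ⟨P, rfl⟩ := FreeSemigroup.exists_toWord_eq hP0
      rw [mulList_toWord] at hxP
      rw [hxP] at hx
      obtain ⟨t, ht⟩ := exists_eq_mul_right_of_mem hp hx' hx
      rw [← hxP] at ht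
      exact ⟨t * (ofWord (m k) * (β * δ)), by rw [← mul_assoc x, ← ht, mul_assoc (γ * α)]⟩
  · rcases eq_or_ne Q [] with rfl | hQ0
    · exact ⟨γ * α * ofWord (m k), by rw [hzQ]; rfl⟩
    · obtain ⟨Q, rfl⟩ := FreeSemigroup.exists_toWord_eq hQ0
      rw [listMul_toWord] at hzQ
      rw [hzQ] at hz
      obtain ⟨t, ht⟩ := exists_eq_mul_left_of_mem hp hz' hz
      rw [← hzQ] at ht
      exact ⟨γ * α * ofWord (m k) * t, by rw [mul_assoc _ t, ← ht]⟩

end Substitution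

/-- Every orbit in a finite set is eventually periodic. -/
theorem exists_iterate_factorial_fixed {Y : Type*} [Finite Y] (T : Y → Y) (y : Y) :
    ∃ M : ℕ, ∀ k ≥ M, ∀ m ≥ M, T^[k.factorial] (T^[m.factorial] y) = T^[m.factorial] y := by
  obtain ⟨i, j, hij, h⟩ : ∃ i j : ℕ, i < j ∧ T^[i] y = T^[j] y := by
    obtain ⟨i, j, hne, h⟩ := Finite.exists_ne_map_eq_of_infinite fun k : ℕ => T^[k] y
    rcases lt_or_gt_of_ne hne with h' | h'
    exacts [⟨i, j, h', h⟩, ⟨j, i, h', h.symm⟩]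
  have h1 : Function.IsPeriodicPt T (j - i) (T^[i] y) := by
    rw [Function.IsPeriodicPt, Function.IsFixedPt, ← Function.iterate_add_apply,
      Nat.sub_add_cancel hij.le, h]
  refine ⟨j, fun k hk m hm => ?_⟩
  obtain ⟨l, hl⟩ := Nat.exists_eq_add_of_le' ((hij.le.trans hm).trans (Nat.self_le_factorial m))
  have h2 : Function.IsPeriodicPt T (j - i) (T^[m.factorial] y) := by
    rw [hl, Function.iterate_add_apply]
    exact h1.apply_iterate l
  exact h2.trans_dvd (Nat.dvd_factorial (by omega) (by omega))

namespace FreeSemigroup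

variable {A : Type*}

theorem last_mul (u v : FreeSemigroup A) : (u * v).last = v.last := by
  unfold last
  simp only [toWord_mul]
  exact List.getLast_append_of_ne_nil _ v.toWord_ne_nil

theorem eq_of_or_of_mul (w : FreeSemigroup A) : w = of w.head ∨ ∃ v, w = of w.head * v := by
  obtain ⟨a, l⟩ := w
  cases l with
  | nil => exact Or.inl rfl
  | cons b l => exact Or.inr ⟨⟨b, l⟩, rfl⟩

theorem eq_of_or_mul_of (w : FreeSemigroup A) : w = of w.last ∨ ∃ v, w = v * of w.last := by
  induction w using FreeSemigroup.recOnMul with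
  | ih1 a => exact Or.inl rfl
  | ih2 a w _ hw =>
    rw [last_mul]
    rcases hw with h | ⟨v, h⟩
    · exact Or.inr ⟨of a, congrArg (of a * ·) h⟩
    · exact Or.inr ⟨of a * v, (congrArg (of a * ·) h).trans (mul_assoc _ _ _).symm⟩

theorem apply_head {φ : Substitution A} {a : A} (h : ∀ x, (φ (of x)).head = a)
    (w : FreeSemigroup A) : (φ w).head = a := by
  induction w using FreeSemigroup.recOnMul with
  | ih1 x => exact h x
  | ih2 x w hx _ => rw [map_mul, head_mul, hx]

theorem apply_last {φ : Substitution A} {a : A} (h : ∀ x, (φ (of x)).last = a)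
    (w : FreeSemigroup A) : (φ w).last = a := by
  induction w using FreeSemigroup.recOnMul with
  | ih1 x => exact h x
  | ih2 x w _ hw => rw [map_mul, last_mul, hw]

end FreeSemigroup

open FreeProfiniteSemigroup

/-! ### The idempotent power of φ -/

namespace FreeProfiniteSemigroup

variable {A : Type*} (φ : Substitution A)

theorem iterate_extend_ofWord (k : ℕ) (w : FreeSemigroup A) :
    (extend φ)^[k] (ofWord w) = ofWord (φ^[k] w) :=
  ((Function.Semiconj.iterate_right (f := ofWord) (ga := φ) (gb := extend φ)
    (fun _ => rfl) k) w).symm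

/-- The action of a substitution on the assignments of elements of a finite quotient to letters. -/
def coordStep (c : FiniteCon A) (s : A → c.1.Quotient) (a : A) : c.1.Quotient :=
  FreeSemigroup.lift s (φ (FreeSemigroup.of a))

/-- Modulo c, the iterates of φ are governed by the orbit of one point under a self-map of a finite
set. -/
theorem iterate_coord (c : FiniteCon A) (k : ℕ) (w : FreeSemigroup A) :
    ((φ^[k] w : FreeSemigroup A) : c.1.Quotient) = FreeSemigroup.lift
      ((coordStep φ c)^[k] fun a => ((FreeSemigroup.of a : FreeSemigroup A) : c.1.Quotient)) w := by
  induction k generalizing w with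
  | zero =>
    induction w using FreeSemigroup.recOnMul with
    | ih1 a => rfl
    | ih2 a w ha hw => rw [map_mul, ← ha, ← hw]; rfl
  | succ k ih =>
    rw [Function.iterate_succ_apply, ih, Function.iterate_succ_apply']
    induction w using FreeSemigroup.recOnMul with
    | ih1 a => rw [FreeSemigroup.lift_of]; rfl
    | ih2 a w ha hw => rw [map_mul, map_mul, map_mul, ← ha, ← hw]

variable [Finite A]

theorem omegaPow_mul (x y : FreeProfiniteSemigroup A) :
    omegaPow (extend φ) (x * y) = omegaPow (extend φ) x * omegaPow (extend φ) y := by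
  refine tendsto_nhds_unique (tendsto_omegaPow φ (x * y)) ?_
  simp only [iterate_map_mul]
  exact (tendsto_omegaPow φ x).mul (tendsto_omegaPow φ y)

theorem extend_omegaPow (x : FreeProfiniteSemigroup A) :
    extend φ (omegaPow (extend φ) x) = omegaPow (extend φ) (extend φ x) := by
  refine tendsto_nhds_unique (((continuous_extend φ).tendsto _).comp (tendsto_omegaPow φ x)) ?_
  refine (tendsto_omegaPow φ (extend φ x)).congr fun n => ?_
  rw [Function.comp_apply, ← Function.iterate_succ_apply' (extend φ),
    Function.iterate_succ_apply]

theorem iterate_extend_omegaPow (k : ℕ) (x : FreeProfiniteSemigroup A) :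
    (extend φ)^[k] (omegaPow (extend φ) x) = omegaPow (extend φ) ((extend φ)^[k] x) := by
  induction k generalizing x with
  | zero => rfl
  | succ k ih => rw [Function.iterate_succ_apply, extend_omegaPow, ih, Function.iterate_succ_apply]

/-- The element `φ^ω(a)`. -/
noncomputable abbrev gen (a : A) : FreeProfiniteSemigroup A :=
  omegaPow (extend φ) (ofWord (FreeSemigroup.of a))

theorem eventually_coord_eq (c : FiniteCon A) (x : FreeProfiniteSemigroup A) :
    ∀ᶠ n : ℕ in atTop, ((extend φ)^[n.factorial] x).1 c = (omegaPow (extend φ) x).1 c :=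
  (tendsto_omegaPow φ x).eventually ((isOpen_coord c _).mem_nhds rfl)

/-- Idempotence of `φ^ω`: modulo each c, for large k and m the iterate of order k! + m! agrees with
that of order m!, as the orbit of `coordStep` is eventually periodic. -/
theorem omegaPow_gen (a : A) : omegaPow (extend φ) (gen φ a) = gen φ a := by
  refine Subtype.ext (funext fun c => ?_)
  obtain ⟨M, hM⟩ := exists_iterate_factorial_fixed (coordStep φ c)
    fun a => ((FreeSemigroup.of a : FreeSemigroup A) : c.1.Quotient)
  obtain ⟨k, hk, hkM⟩ := ((eventually_coord_eq φ c (gen φ a)).and (eventually_ge_atTop M)).exists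
  have h1 : ∀ᶠ m : ℕ in atTop, ((extend φ)^[k.factorial]
      ((extend φ)^[m.factorial] (ofWord (FreeSemigroup.of a)))).1 c =
      ((extend φ)^[k.factorial] (gen φ a)).1 c :=
    ((((continuous_extend φ).iterate _).tendsto _).comp (tendsto_omegaPow φ _)).eventually
      ((isOpen_coord c _).mem_nhds rfl)
  obtain ⟨m, ⟨hm, hm'⟩, hmM⟩ := ((h1.and (eventually_coord_eq φ c
    (ofWord (FreeSemigroup.of a)))).and (eventually_ge_atTop M)).exists
  rw [← hk, ← hm, ← hm', ← Function.iterate_add_apply, iterate_extend_ofWord,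
    iterate_extend_ofWord]
  change ((φ^[_] _ : FreeSemigroup A) : c.1.Quotient) = ((φ^[_] _ : FreeSemigroup A) : c.1.Quotient)
  rw [iterate_coord, iterate_coord, Function.iterate_add_apply, hM k hkM m hmM]

/-- An element that lies in all the images of iterates of `φ` is a limit of values of `φ^ω`. -/
theorem mem_closure_omegaPow {x : FreeProfiniteSemigroup A}
    (hx : ∀ n, ∃ y, (extend φ)^[n] y = x) :
    x ∈ closure (Set.range fun w : FreeSemigroup A => omegaPow (extend φ) (ofWord w)) := by
  refine mem_closure_iff_coord.2 fun c => ?_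
  -- One exponent k! serves all letters, so this iterate agrees with `φ^ω` modulo c on all words.
  -- The element y with image x is then approximated by a word.
  obtain ⟨k, hk⟩ := (eventually_all.2 fun a =>
    eventually_coord_eq φ c (ofWord (FreeSemigroup.of a))).exists
  obtain ⟨y, hy⟩ := hx k.factorial
  have hopen := (isOpen_coord c (x.1 c)).preimage ((continuous_extend φ).iterate k.factorial)
  obtain ⟨w, hw⟩ := denseRange_ofWord.exists_mem_open hopen ⟨y, by
    rw [Set.mem_preimage, hy]; rfl⟩
  refine ⟨_, ⟨w, rfl⟩, ?_⟩
  rw [← show ((extend φ)^[k.factorial] (ofWord w)).1 c = x.1 c from hw]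
  clear hw
  induction w using FreeSemigroup.recOnMul with
  | ih1 a => exact hk a
  | ih2 a w ha hw =>
    simp only [ofWord_mul, iterate_map_mul, omegaPow_mul]
    exact congrArg₂ (· * ·) ha hw

end FreeProfiniteSemigroup

/-! ### The compact semigroup containing the generators -/

namespace Substitution

variable {A : Type*} {φ : Substitution A}

/-- For any two consecutive letters c, d of an iterate, ba appears where `φ(c)` meets `φ(d)`. -/
theorem pair_mem_lang (hp : φ.WeaklyPrimitive) {a b : A}
    (ha : ∀ x : A, (φ (FreeSemigroup.of x)).head = a)
    (hb : ∀ x : A, (φ (FreeSemigroup.of x)).last = b) [Nonempty A] :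
    FreeSemigroup.of b * FreeSemigroup.of a ∈ φ.language := by
  obtain ⟨n, hn⟩ := hp.exists_letters
  obtain ⟨K, hK⟩ := hn.exists_length_le 2
  rw [mem_language_iff]
  refine frequently_atTop.2 fun N => ⟨N + K + 1, by omega, Classical.arbitrary A, ?_⟩
  rw [Function.iterate_succ_apply']
  have h := hK (N + K) (by omega) (Classical.arbitrary A)
  match (ListSubst.map φ.letters)^[N + K] [Classical.arbitrary A], h with
  | c :: d :: l, _ =>
    have hc : [b] <:+ φ.letters c := by
      rw [← hb c, FreeSemigroup.last]
      exact ⟨_, List.dropLast_append_getLast _⟩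
    have hd : [a] <+: φ.letters d := by
      rw [← ha d]
      exact ⟨_, rfl⟩
    obtain ⟨u, hu⟩ := hc
    obtain ⟨v, hv⟩ := hd
    refine ⟨u, v ++ ListSubst.map φ.letters l, ?_⟩
    rw [ListSubst.map_cons, ListSubst.map_cons, ← hu, ← hv, FreeSemigroup.toWord_mul]
    simp [FreeSemigroup.toWord_of]

/-- Under weak primitivity a letter of A may fail to be in the language. But a letter of the n-th
iterate belongs to a pair there, which occurs in the n-th iterate of every letter and so in all
later iterates. -/
theorem exists_iterate_letters_mem_lang (hp : φ.WeaklyPrimitive) :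
    ∃ n, ∀ a, ∀ c ∈ (φ^[n] (FreeSemigroup.of a)).toWord, FreeSemigroup.of c ∈ φ.language := by
  obtain ⟨n, hn⟩ := hp.exists_letters
  refine ⟨n, fun a c hc => ?_⟩
  rw [toWord_iterate, FreeSemigroup.toWord_of] at hc
  obtain ⟨x, y, hxy, hcxy⟩ : ∃ x y, [x, y] <:+: (ListSubst.map φ.letters)^[n] [a] ∧
      [c] <:+: [x, y] := by
    have h2 := hn.two_le a
    obtain ⟨u, v, h⟩ := List.append_of_mem hc
    rw [h] at h2 ⊢
    cases v with
    | cons y v => exact ⟨c, y, ⟨u, v, by simp⟩, ⟨[], [y], rfl⟩⟩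
    | nil =>
      rcases List.eq_nil_or_concat u with rfl | ⟨u, x, rfl⟩
      · simp at h2
      · exact ⟨x, c, ⟨u, [], by simp⟩, ⟨[x], [], rfl⟩⟩
  rw [mem_language_iff]
  refine ListSubst.lang_infix ?_ hcxy
  refine frequently_atTop.2 fun N => ⟨n + N, by omega, a, ?_⟩
  rw [Function.iterate_add_apply]
  obtain ⟨d, l, h⟩ := List.exists_cons_of_ne_nil
    (ListSubst.iterate_ne_nil φ.letters_ne_nil N (List.cons_ne_nil a []))
  rw [h, ← List.singleton_append (x := d), ListSubst.iterate_append]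
  exact List.infix_append_of_infix_left (hn.pairs _ _ _ _ hxy)

theorem eventually_length_le (hp : φ.WeaklyPrimitive) (n : ℕ) (w : FreeSemigroup A) :
    ∀ᶠ k : ℕ in atTop, n ≤ (φ^[k.factorial] w).toWord.length := by
  obtain ⟨m, hm⟩ := hp.exists_letters
  obtain ⟨K, hK⟩ := hm.exists_length_le n
  filter_upwards [eventually_ge_atTop K] with k hk
  rw [toWord_iterate]
  obtain ⟨c, l, h⟩ := List.exists_cons_of_ne_nil w.toWord_ne_nil
  rw [h, ← List.singleton_append, ListSubst.iterate_append, List.length_append]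
  exact (hK _ (hk.trans (Nat.self_le_factorial k)) c).trans (Nat.le_add_right _ _)

theorem iterate_factorial_eq_apply (k : ℕ) (w : FreeSemigroup A) :
    ∃ v, φ^[k.factorial] w = φ v := by
  obtain ⟨m, hm⟩ := Nat.exists_eq_succ_of_ne_zero (Nat.factorial_ne_zero k)
  exact ⟨φ^[m] w, by rw [hm, Function.iterate_succ_apply']⟩

variable [Finite A]

theorem omegaPow_mem_jClass (hp : φ.WeaklyPrimitive) {w : FreeSemigroup A}
    (hw : w ∈ φ.language) : omegaPow (extend φ) (ofWord w) ∈ φ.jClass := by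
  refine mem_jClass_iff_long.2 fun n => mem_closure_of_tendsto (tendsto_omegaPow φ _) ?_
  filter_upwards [eventually_length_le hp n w] with k hk
  rw [iterate_extend_ofWord]
  refine ⟨_, ⟨?_, hk⟩, rfl⟩
  rw [mem_language_iff, toWord_iterate]
  exact ListSubst.iterate_mem_lang ((mem_language_iff φ).1 hw) _

/-- The long iterates of c begin with a, hence so does their limit `φ^ω(c)`. Applying the
idempotent, multiplicative map `φ^ω` replaces a by `φ^ω(a)`. -/
theorem gen_eq_gen_mul (hp : φ.WeaklyPrimitive) {a : A}
    (ha : ∀ x : A, (φ (FreeSemigroup.of x)).head = a) (c : A) : ∃ t, gen φ c = gen φ a * t := by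
  have h1 : gen φ c ∈ Set.range (ofWord (FreeSemigroup.of a) * ·) := by
    refine (isCompact_range (continuous_const_mul _)).isClosed.mem_of_tendsto
      (tendsto_omegaPow φ _) ?_
    filter_upwards [eventually_length_le hp 2 (FreeSemigroup.of c)] with k hk
    rw [iterate_extend_ofWord]
    obtain ⟨v, hv⟩ := iterate_factorial_eq_apply (φ := φ) k (FreeSemigroup.of c)
    rw [hv] at hk ⊢
    rcases (φ v).eq_of_or_of_mul with h | ⟨u, h⟩ <;> rw [FreeSemigroup.apply_head ha] at h
    · rw [h] at hk
      exact absurd hk (by simp [FreeSemigroup.toWord_of])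
    · exact ⟨ofWord u, by rw [h]; rfl⟩
  obtain ⟨t, ht⟩ := h1
  refine ⟨omegaPow (extend φ) t, ?_⟩
  rw [← omegaPow_mul, ← omegaPow_gen]
  exact congrArg _ ht.symm

theorem gen_eq_mul_gen (hp : φ.WeaklyPrimitive) {b : A}
    (hb : ∀ x : A, (φ (FreeSemigroup.of x)).last = b) (c : A) : ∃ t, gen φ c = t * gen φ b := by
  have h1 : gen φ c ∈ Set.range (· * ofWord (FreeSemigroup.of b)) := by
    refine (isCompact_range (continuous_mul_const _)).isClosed.mem_of_tendsto
      (tendsto_omegaPow φ _) ?_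
    filter_upwards [eventually_length_le hp 2 (FreeSemigroup.of c)] with k hk
    rw [iterate_extend_ofWord]
    obtain ⟨v, hv⟩ := iterate_factorial_eq_apply (φ := φ) k (FreeSemigroup.of c)
    rw [hv] at hk ⊢
    rcases (φ v).eq_of_or_mul_of with h | ⟨u, h⟩ <;> rw [FreeSemigroup.apply_last hb] at h
    · rw [h] at hk
      exact absurd hk (by simp [FreeSemigroup.toWord_of])
    · exact ⟨ofWord u, by rw [h]; rfl⟩
  obtain ⟨t, ht⟩ := h1
  refine ⟨omegaPow (extend φ) t, ?_⟩
  rw [← omegaPow_mul, ← omegaPow_gen]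
  exact congrArg _ ht.symm

/-- The image under `φ` of a generator `φ^ω(c)` is a multiple of `φ^ω(a)`. -/
theorem extend_gen_eq_gen_mul (hp : φ.WeaklyPrimitive) {a : A}
    (ha : ∀ x : A, (φ (FreeSemigroup.of x)).head = a) (c : A) :
    ∃ t, extend φ (gen φ c) = gen φ a * t := by
  rw [gen, extend_omegaPow, extend_ofWord]
  rcases (φ (FreeSemigroup.of c)).eq_of_or_of_mul with h | ⟨v, h⟩ <;> rw [ha] at h <;> rw [h]
  · exact gen_eq_gen_mul hp ha a
  · exact ⟨_, by rw [ofWord_mul, omegaPow_mul]⟩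

theorem extend_gen_eq_mul_gen (hp : φ.WeaklyPrimitive) {b : A}
    (hb : ∀ x : A, (φ (FreeSemigroup.of x)).last = b) (c : A) :
    ∃ t, extend φ (gen φ c) = t * gen φ b := by
  rw [gen, extend_omegaPow, extend_ofWord]
  rcases (φ (FreeSemigroup.of c)).eq_of_or_mul_of with h | ⟨v, h⟩ <;> rw [hb] at h <;> rw [h]
  · exact gen_eq_mul_gen hp hb b
  · exact ⟨_, by rw [ofWord_mul, omegaPow_mul]⟩

/-- The elements of `J(φ)` that begin with `φ^ω(a)` and end with `φ^ω(b)`. -/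
def hClass (φ : Substitution A) (a b : A) : Set (FreeProfiniteSemigroup A) :=
  φ.jClass ∩ (Set.range (gen φ a * ·) ∩ Set.range (· * gen φ b))

theorem isClosed_hClass (a b : A) : IsClosed (φ.hClass a b) :=
  isClosed_jClass.inter ((isCompact_range (continuous_const_mul _)).isClosed.inter
    (isCompact_range (continuous_mul_const _)).isClosed)

/-- Because ba is in the language, `φ^ω(b)φ^ω(a)` is in J(φ). The end of x thus tolerates
multiplication by `φ^ω(a)`, the beginning of y, and stability keeps xy in J(φ). -/
theorem mul_mem_hClass (hp : φ.WeaklyPrimitive) {a b : A}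
    (hba : FreeSemigroup.of b * FreeSemigroup.of a ∈ φ.language)
    {x y : FreeProfiniteSemigroup A} (hx : x ∈ φ.hClass a b) (hy : y ∈ φ.hClass a b) :
    x * y ∈ φ.hClass a b := by
  obtain ⟨hxJ, ⟨x₁, hx₁⟩, x₂, hx₂⟩ := hx
  obtain ⟨hyJ, ⟨y₁, hy₁⟩, y₂, hy₂⟩ := hy
  dsimp only at hx₁ hx₂ hy₁ hy₂
  have hgb := omegaPow_mem_jClass hp (mem_language_of_mul_left hba)
  have hga := omegaPow_mem_jClass hp (mem_language_of_mul_right hba)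
  have hgba := omegaPow_mem_jClass hp hba
  rw [ofWord_mul, omegaPow_mul] at hgba
  obtain ⟨r, hr⟩ := exists_eq_mul_right_of_mem hp hgb hgba
  have h1 : x * gen φ a ∈ φ.jClass := by
    refine mem_jClass_of_mul_mul_left (z := r) hxJ ?_
    have : x * gen φ a * r = x := by
      calc x * gen φ a * r = x₂ * gen φ b * gen φ a * r := by rw [hx₂]
        _ = x₂ * (gen φ b * gen φ a * r) := by simp only [mul_assoc]
        _ = x := by rw [← hr, hx₂]
    rwa [this]
  obtain ⟨r', hr'⟩ := exists_eq_mul_left_of_mem hp hga h1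
  refine ⟨mem_jClass_of_mul_mul_right (z := r') hyJ ?_, ⟨x₁ * y, ?_⟩, ⟨x * y₂, ?_⟩⟩
  · have : r' * (x * y) = y := by
      calc r' * (x * y) = r' * (x * (gen φ a * y₁)) := by rw [hy₁]
        _ = r' * (x * gen φ a) * y₁ := by simp only [mul_assoc]
        _ = y := by rw [← hr', hy₁]
    rwa [this]
  · dsimp only
    rw [← mul_assoc, hx₁]
  · dsimp only
    rw [mul_assoc, hy₂]

theorem extend_mem_hClass (hp : φ.WeaklyPrimitive) {a b : A}
    (ha : ∀ x : A, (φ (FreeSemigroup.of x)).head = a)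
    (hb : ∀ x : A, (φ (FreeSemigroup.of x)).last = b)
    {x : FreeProfiniteSemigroup A} (hx : x ∈ φ.hClass a b) : extend φ x ∈ φ.hClass a b := by
  obtain ⟨hxJ, ⟨x₁, hx₁⟩, x₂, hx₂⟩ := hx
  dsimp only at hx₁ hx₂
  obtain ⟨t, ht⟩ := extend_gen_eq_gen_mul hp ha a
  obtain ⟨t', ht'⟩ := extend_gen_eq_mul_gen hp hb b
  refine ⟨extend_mem_jClass hxJ, ⟨t * extend φ x₁, ?_⟩, ⟨extend φ x₂ * t', ?_⟩⟩
  · dsimp only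
    rw [← mul_assoc, ← ht, ← map_mul, hx₁]
  · dsimp only
    rw [mul_assoc, ← ht', ← map_mul, hx₂]

theorem iterate_extend_mem_hClass (hp : φ.WeaklyPrimitive) {a b : A}
    (ha : ∀ x : A, (φ (FreeSemigroup.of x)).head = a)
    (hb : ∀ x : A, (φ (FreeSemigroup.of x)).last = b) (k : ℕ)
    {x : FreeProfiniteSemigroup A} (hx : x ∈ φ.hClass a b) :
    (extend φ)^[k] x ∈ φ.hClass a b := by
  induction k generalizing x with
  | zero => exact hx
  | succ k ih => exact ih (extend_mem_hClass hp ha hb hx)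

/-- A letter c outside the language is handled through its n-th iterate, a product of letters of the
language: the image of `φ^ω(c)` under the n-th iterate of φ is in `hClass`, which is closed and
stable under φ, and `φ^ω(c)` is a limit of further images. -/
theorem gen_mem_hClass [Nonempty A] (hp : φ.WeaklyPrimitive) {a b : A}
    (ha : ∀ x : A, (φ (FreeSemigroup.of x)).head = a)
    (hb : ∀ x : A, (φ (FreeSemigroup.of x)).last = b) (c : A) : gen φ c ∈ φ.hClass a b := by
  have h0 : ∀ d, FreeSemigroup.of d ∈ φ.language → gen φ d ∈ φ.hClass a b := by
    intro d hd
    obtain ⟨t, ht⟩ := gen_eq_gen_mul hp ha d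
    obtain ⟨t', ht'⟩ := gen_eq_mul_gen hp hb d
    exact ⟨omegaPow_mem_jClass hp hd, ⟨t, ht.symm⟩, ⟨t', ht'.symm⟩⟩
  have h1 : ∀ w : FreeSemigroup A, (∀ d ∈ w.toWord, FreeSemigroup.of d ∈ φ.language) →
      omegaPow (extend φ) (ofWord w) ∈ φ.hClass a b := by
    intro w hw
    induction w using FreeSemigroup.recOnMul with
    | ih1 d => exact h0 d (hw d List.mem_cons_self)
    | ih2 d w _ h2 =>
      rw [ofWord_mul, omegaPow_mul]
      refine mul_mem_hClass hp (pair_mem_lang hp ha hb) (h0 d (hw d List.mem_cons_self)) (h2 ?_)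
      exact fun d' hd' => hw d' (List.mem_cons_of_mem _ hd')
  obtain ⟨n, hn⟩ := exists_iterate_letters_mem_lang hp
  have h2 := h1 _ (hn c)
  rw [← iterate_extend_ofWord, ← iterate_extend_omegaPow] at h2
  have h3 := tendsto_omegaPow φ (gen φ c)
  rw [omegaPow_gen] at h3
  refine (isClosed_hClass a b).mem_of_tendsto h3 ?_
  filter_upwards [eventually_ge_atTop n] with k hk
  obtain ⟨j, hj⟩ := Nat.exists_eq_add_of_le' (hk.trans (Nat.self_le_factorial k))
  rw [hj, Function.iterate_add_apply]
  exact iterate_extend_mem_hClass hp ha hb j h2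

theorem exists_idempotent [Nonempty A] (hp : φ.WeaklyPrimitive) {a b : A}
    (ha : ∀ x : A, (φ (FreeSemigroup.of x)).head = a)
    (hb : ∀ x : A, (φ (FreeSemigroup.of x)).last = b) :
    ∃ e ∈ φ.jClass, e * e = e ∧ extend φ e = e ∧
      ∀ x ∈ φ.hClass a b, e * x = x ∧ x * e = x := by
  obtain ⟨e, he, hee⟩ := exists_idempotent_in_compact_subsemigroup
    (fun r => continuous_mul_const r) (φ.hClass a b) ⟨_, gen_mem_hClass hp ha hb a⟩
    (isClosed_hClass a b).isCompact
    fun x hx y hy => mul_mem_hClass hp (pair_mem_lang hp ha hb) hx hy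
  have hga := (gen_mem_hClass hp ha hb a).1
  have hgb := (gen_mem_hClass hp ha hb b).1
  -- The idempotent e begins with `φ^ω(a)`, so by stability `φ^ω(a)` is a right multiple of e and is
  -- fixed by e on the left; dually for `φ^ω(b)`.
  have key : ∀ x ∈ φ.hClass a b, e * x = x ∧ x * e = x := by
    obtain ⟨heJ, ⟨s, hs⟩, s', hs'⟩ := id he
    dsimp only at hs hs'
    obtain ⟨t, ht⟩ := exists_eq_mul_right_of_mem hp hga (y := s) (by rwa [hs])
    obtain ⟨t', ht'⟩ := exists_eq_mul_left_of_mem hp hgb (x := s') (by rwa [hs'])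
    rw [hs] at ht
    rw [hs'] at ht'
    have h1 : e * gen φ a = gen φ a := by rw [ht, ← mul_assoc, hee]
    have h2 : gen φ b * e = gen φ b := by rw [ht', mul_assoc, hee]
    rintro _ ⟨-, ⟨x₁, rfl⟩, x₂, hx₂⟩
    dsimp only at hx₂ ⊢
    refine ⟨by rw [← mul_assoc, h1], ?_⟩
    rw [← hx₂, mul_assoc, h2]
  refine ⟨e, he.1, hee, ?_, key⟩
  have hf := extend_mem_hClass hp ha hb he
  obtain ⟨h1, h2⟩ := key _ hf
  -- Now φ(e) is an idempotent for which e acts as identity, and e is a right multiple of it. This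
  -- forces φ(e) = e.
  obtain ⟨t, ht⟩ := exists_eq_mul_right_of_mem hp he.1 (y := extend φ e) (by rw [h1]; exact hf.1)
  rw [h1] at ht
  calc extend φ e = extend φ e * (extend φ e * t) := by rw [← ht, h2]
    _ = extend φ (e * e) * t := by rw [map_mul, mul_assoc]
    _ = e := by rw [hee, ← ht]

/-- Under bounded delay, every element of the group in `J(φ)` at a fixed idempotent is an image. -/
theorem exists_extend_eq (hp : φ.WeaklyPrimitive) (hinj : Function.Injective φ)
    {N : ℕ} (hd : ListSubst.Delay φ.letters N)
    (hpre : ∀ w ∈ ListSubst.lang φ.letters,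
      ∃ v ∈ ListSubst.lang φ.letters, w <:+: ListSubst.map φ.letters v)
    {e : FreeProfiniteSemigroup A} (he : e ∈ φ.jClass) (hee : e * e = e) (hφe : extend φ e = e)
    {x : FreeProfiniteSemigroup A} (hx : x ∈ φ.jClass) (hex : e * x = x) (hxe : x * e = x) :
    ∃ y ∈ φ.jClass, e * y = y ∧ y * e = y ∧ extend φ y = x := by
  obtain ⟨M, hM⟩ := (Set.finite_range fun c => (φ.letters c).length).bddAbove
  have hM' : ∀ c, (φ.letters c).length ≤ M + 1 := fun c => (hM ⟨c, rfl⟩).trans (Nat.le_succ M)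
  let F : Set (FreeSemigroup A) := {w | w.toWord.length ≤ M + 1}
  have hF : F.Finite := FreeSemigroup.finite_toWord_length_le _
  -- Desubstitution up to short ends passes to limits: there are finitely many pairs (s, t), and for
  -- each the set of products sφ(z)t is compact.
  have h1 : closure (ofWord '' {w ∈ φ.language | 2 * (M + 1) + 1 ≤ w.toWord.length}) ⊆
      ⋃ s ∈ F, ⋃ t ∈ F, (fun z => ofWord s * extend φ z * ofWord t) ''
        closure (ofWord '' φ.language) := by
    refine closure_minimal ?_ (hF.isClosed_biUnion fun s _ => hF.isClosed_biUnion fun t _ =>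
      (isClosed_closure.isCompact.image ?_).isClosed)
    · rintro _ ⟨w, ⟨hw, hlen⟩, rfl⟩
      obtain ⟨s, z, t, hszt, hz, hs0, hz0, ht0, hs, ht⟩ := ListSubst.desubstitute hM'
        (Nat.succ_pos M) hpre ((mem_language_iff φ).1 hw) hlen
      obtain ⟨s, rfl⟩ := FreeSemigroup.exists_toWord_eq hs0
      obtain ⟨t, rfl⟩ := FreeSemigroup.exists_toWord_eq ht0
      obtain ⟨z, rfl⟩ := FreeSemigroup.exists_toWord_eq hz0
      rw [← toWord_apply] at hszt
      obtain rfl : w = s * φ z * t := FreeSemigroup.toWord_injective hszt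
      refine Set.mem_biUnion hs (Set.mem_biUnion ht ⟨ofWord z, subset_closure ⟨z, ?_, rfl⟩, rfl⟩)
      exact (mem_language_iff φ).2 hz
    · have := continuous_extend φ
      fun_prop
  have h2 := h1 (mem_jClass_iff_long.1 hx _)
  simp only [Set.mem_iUnion] at h2
  obtain ⟨s, -, t, -, z, hz, rfl⟩ := h2
  dsimp only at hx hex hxe
  have hzJ : z ∈ φ.jClass := by
    refine mem_jClass_iff.2 ⟨hz, ?_⟩
    rintro ⟨w, rfl⟩
    exact notMem_range_of_mem_jClass hx ⟨s * φ w * t, rfl⟩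
  -- The fixed idempotent e = φ(e) supplies an image to the left of s; afterwards it is used to the
  -- right of t.
  have h3 : extend φ e * ofWord s * extend φ z ∈ φ.jClass := by
    rw [hφe, mul_assoc]
    refine mem_jClass_of_mul_mul_left (z := ofWord t) he ?_
    rwa [mul_assoc e, hex]
  obtain ⟨y₁, hy₁, hy₁', ⟨t₁, ht₁⟩, -⟩ := exists_junction hp hinj hd hpre s he hzJ h3
  have h4 : extend φ y₁ * ofWord t * extend φ e = ofWord s * extend φ z * ofWord t := by
    rw [hy₁', hφe]
    calc _ = e * (ofWord s * extend φ z * ofWord t) * e := by simp only [mul_assoc]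
      _ = _ := by rw [hex, hxe]
  obtain ⟨y, hy, hy', ⟨t₂, ht₂⟩, t₃, ht₃⟩ := exists_junction hp hinj hd hpre t hy₁ he (by rwa [h4])
  refine ⟨y, hy, ?_, ?_, by rw [hy', h4]⟩
  · rw [ht₂, ht₁, ← mul_assoc, ← mul_assoc, hee]
  · rw [ht₃, mul_assoc, hee]

theorem exists_iterate_extend_eq (hp : φ.WeaklyPrimitive) (hinj : Function.Injective φ)
    {N : ℕ} (hd : ListSubst.Delay φ.letters N)
    (hpre : ∀ w ∈ ListSubst.lang φ.letters,
      ∃ v ∈ ListSubst.lang φ.letters, w <:+: ListSubst.map φ.letters v)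
    {e : FreeProfiniteSemigroup A} (he : e ∈ φ.jClass) (hee : e * e = e) (hφe : extend φ e = e)
    {x : FreeProfiniteSemigroup A} (hx : x ∈ φ.jClass) (hex : e * x = x) (hxe : x * e = x)
    (n : ℕ) : ∃ y, (extend φ)^[n] y = x := by
  induction n generalizing x with
  | zero => exact ⟨x, rfl⟩
  | succ n ih =>
    obtain ⟨y, hy, hey, hye, rfl⟩ := exists_extend_eq hp hinj hd hpre he hee hφe hx hex hxe
    obtain ⟨z, rfl⟩ := ih hy hey hye
    exact ⟨z, Function.iterate_succ_apply' _ _ _⟩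

end Substitution

/-! ## Maximal subgroups of compact semigroups -/

/-- The graph of inversion is closed, and projections of compact sets are compact. -/
theorem continuous_inv_of_compactSpace {G : Type*} [Group G] [TopologicalSpace G] [CompactSpace G]
    [T2Space G] [ContinuousMul G] : Continuous fun x : G => x⁻¹ := by
  refine continuous_iff_isClosed.2 fun C hC => ?_
  have h : (fun x : G => x⁻¹) ⁻¹' C = Prod.fst '' ({p : G × G | p.1 * p.2 = 1} ∩ Prod.snd ⁻¹' C) := by
    ext x
    constructor
    · exact fun hx => ⟨(x, x⁻¹), ⟨mul_inv_cancel x, hx⟩, rfl⟩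
    · rintro ⟨⟨x, y⟩, ⟨h, hy⟩, rfl⟩
      have : x⁻¹ = y := inv_eq_of_mul_eq_one_right h
      simpa [this] using hy
  rw [h]
  exact ((IsClosed.inter (isClosed_eq continuous_mul continuous_const)
    (hC.preimage continuous_snd)).isCompact.image continuous_fst).isClosed

namespace MaximalSubgroup

variable {S : Type*} [Semigroup S] {e : S} {he : IsIdempotentElem e}

theorem ext {x y : MaximalSubgroup he} (h : x.1 = y.1) : x = y := Subtype.ext h

theorem val_mul (x y : MaximalSubgroup he) : (x * y).1 = x.1 * y.1 := rfl

theorem val_one : (1 : MaximalSubgroup he).1 = e := rfl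

theorem mul_left (x : MaximalSubgroup he) : e * x.1 = x.1 := x.2.1.1

theorem mul_right (x : MaximalSubgroup he) : x.1 * e = x.1 := x.2.1.2

/-- A homomorphism from a semigroup to a group restricts to the maximal subgroups. -/
noncomputable def toGroup {G : Type*} [Group G] (θ : S →ₙ* G) : MaximalSubgroup he →* G :=
  MonoidHom.mk' (fun x => θ x.1) fun x y => map_mul θ x.1 y.1

variable [TopologicalSpace S]

theorem continuous_val : Continuous fun x : MaximalSubgroup he => x.1 := continuous_subtype_val

instance [T2Space S] : T2Space (MaximalSubgroup he) := inferInstanceAs (T2Space (Subtype _))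

instance [TotallyDisconnectedSpace S] : TotallyDisconnectedSpace (MaximalSubgroup he) :=
  inferInstanceAs (TotallyDisconnectedSpace (Subtype _))

instance [ContinuousMul S] : ContinuousMul (MaximalSubgroup he) :=
  ⟨Continuous.subtype_mk ((continuous_val.comp continuous_fst).mul
    (continuous_val.comp continuous_snd)) _⟩

instance [CompactSpace S] [T2Space S] [ContinuousMul S] : CompactSpace (MaximalSubgroup he) := by
  refine isCompact_iff_compactSpace.1 (IsClosed.isCompact ?_)
  have h : {x : S | (e * x = x ∧ x * e = x) ∧ ∃ y, (e * y = y ∧ y * e = y) ∧ x * y = e ∧ y * x = e} =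
      Prod.fst '' {p : S × S | (e * p.1 = p.1 ∧ p.1 * e = p.1) ∧ (e * p.2 = p.2 ∧ p.2 * e = p.2) ∧
        p.1 * p.2 = e ∧ p.2 * p.1 = e} := by
    ext x
    constructor
    · rintro ⟨h, y, h'⟩
      exact ⟨(x, y), ⟨h, h'⟩, rfl⟩
    · rintro ⟨⟨x, y⟩, ⟨h, h'⟩, rfl⟩
      exact ⟨h, y, h'⟩
  change IsClosed {x : S | _}
  rw [h]
  refine (IsClosed.isCompact ?_).image continuous_fst |>.isClosed
  refine IsClosed.inter (IsClosed.inter ?_ ?_) (IsClosed.inter (IsClosed.inter ?_ ?_)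
    (IsClosed.inter ?_ ?_)) <;> exact isClosed_eq (by fun_prop) (by fun_prop)

instance [CompactSpace S] [T2Space S] [ContinuousMul S] :
    IsTopologicalGroup (MaximalSubgroup he) where
  continuous_inv := continuous_inv_of_compactSpace

/-- Idempotents that are related by `a * b = e` and `b * a = f` have isomorphic maximal
subgroups. -/
noncomputable def congr [ContinuousMul S] {f : S} {hf : IsIdempotentElem f} {a b : S} (hab : a * b = e)
    (hba : b * a = f) (hfb : f * b = b) (haf : a * f = a) :
    MaximalSubgroup he ≃ₜ* MaximalSubgroup hf :=
  have heb : b * e = b := by rw [← hab, ← mul_assoc, hba, hfb]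
  have hea : e * a = a := by rw [← hab, mul_assoc, hba, haf]
  have key : ∀ x y : MaximalSubgroup he, (b * x.1 * a) * (b * y.1 * a) = b * (x * y).1 * a := by
    intro x y
    calc (b * x.1 * a) * (b * y.1 * a) = b * x.1 * (a * b) * y.1 * a := by simp only [mul_assoc]
      _ = b * (x.1 * e) * y.1 * a := by rw [hab]; simp only [mul_assoc]
      _ = _ := by rw [mul_right, val_mul]; simp only [mul_assoc]
  have key' : ∀ x y : MaximalSubgroup hf, (a * x.1 * b) * (a * y.1 * b) = a * (x * y).1 * b := by
    intro x y
    calc (a * x.1 * b) * (a * y.1 * b) = a * x.1 * (b * a) * y.1 * b := by simp only [mul_assoc]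
      _ = a * (x.1 * f) * y.1 * b := by rw [hba]; simp only [mul_assoc]
      _ = _ := by rw [mul_right, val_mul]; simp only [mul_assoc]
  have hone : b * e * a = f := by rw [heb, hba]
  have hone' : a * f * b = e := by rw [haf, hab]
  { toFun := fun x => ⟨b * x.1 * a, ⟨by rw [← mul_assoc, ← mul_assoc, hfb],
        by rw [mul_assoc, haf]⟩, b * (x⁻¹).1 * a,
        ⟨by rw [← mul_assoc, ← mul_assoc, hfb], by rw [mul_assoc, haf]⟩,
        by rw [key, mul_inv_cancel, val_one, hone], by rw [key, inv_mul_cancel, val_one, hone]⟩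
    invFun := fun x => ⟨a * x.1 * b, ⟨by rw [← mul_assoc, ← mul_assoc, hea],
        by rw [mul_assoc, heb]⟩, a * (x⁻¹).1 * b,
        ⟨by rw [← mul_assoc, ← mul_assoc, hea], by rw [mul_assoc, heb]⟩,
        by rw [key', mul_inv_cancel, val_one, hone'], by rw [key', inv_mul_cancel, val_one, hone']⟩
    left_inv := fun x => MaximalSubgroup.ext <| by
      change a * (b * x.1 * a) * b = x.1
      calc a * (b * x.1 * a) * b = a * b * x.1 * (a * b) := by simp only [mul_assoc]
        _ = x.1 := by rw [hab, mul_left, mul_right]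
    right_inv := fun x => MaximalSubgroup.ext <| by
      change b * (a * x.1 * b) * a = x.1
      calc b * (a * x.1 * b) * a = b * a * x.1 * (b * a) := by simp only [mul_assoc]
        _ = x.1 := by rw [hba, mul_left, mul_right]
    map_mul' := fun x y => MaximalSubgroup.ext (key x y).symm
    continuous_toFun := Continuous.subtype_mk
      ((continuous_const.mul continuous_val).mul continuous_const) _
    continuous_invFun := Continuous.subtype_mk
      ((continuous_const.mul continuous_val).mul continuous_const) _ }

end MaximalSubgroup

open FreeProfiniteSemigroup

namespace Substitution

variable {A : Type*} [Finite A] {φ : Substitution A} {e f : FreeProfiniteSemigroup A}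

/-- The maximal subgroups contained in `J(φ)` are isomorphic. -/
theorem nonempty_maximalSubgroup_equiv (hp : φ.WeaklyPrimitive) (he : IsIdempotentElem e)
    (hf : IsIdempotentElem f) (heJ : e ∈ φ.jClass) (hfJ : f ∈ φ.jClass) :
    Nonempty (MaximalSubgroup he ≃ₜ* MaximalSubgroup hf) := by
  obtain ⟨s, t, h⟩ := exists_eq_mul_mul hp heJ hfJ
  -- The elements b = fse and a = etf will link the idempotents: ba = f because f = set, and ab is
  -- an idempotent of J(φ) fixed by e on both sides, which stability identifies with e.
  have hba : f * s * e * (e * t * f) = f := by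
    calc f * s * e * (e * t * f) = f * (s * (e * e) * t) * f := by simp only [mul_assoc]
      _ = f := by rw [he, ← h, hf, hf]
  have hidem : e * t * f * (f * s * e) * (e * t * f * (f * s * e)) = e * t * f * (f * s * e) := by
    calc e * t * f * (f * s * e) * (e * t * f * (f * s * e))
        = e * t * f * (f * s * e * (e * t * f)) * (f * s * e) := by simp only [mul_assoc]
      _ = e * t * (f * f) * (f * s * e) := by rw [hba]; simp only [mul_assoc]
      _ = _ := by rw [hf]
  have hJ : e * t * f * (f * s * e) ∈ φ.jClass := by
    refine jClass_of_mul_right (x := f * s * e) (jClass_of_mul_left (y := e * t * f) ?_ ?_) ?_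
    · have : f * s * e * (e * t * f * (f * s * e)) * (e * t * f) = f := by
        calc _ = f * s * e * (e * t * f) * (f * s * e * (e * t * f)) := by simp only [mul_assoc]
          _ = f := by rw [hba, hf]
      rwa [this]
    all_goals
    · intro hr
      have := mem_range_of_mul_mem_range hr
      simp only [mul_assoc] at this
      first
      | exact notMem_range_of_mem_jClass hfJ (mem_range_of_mul_mem_range this.1).1
      | exact notMem_range_of_mem_jClass heJ (mem_range_of_mul_mem_range this.1).1
  have hab : e * t * f * (f * s * e) = e := by
    have h1 : e * (t * f * (f * s * e)) = e * t * f * (f * s * e) := by simp only [mul_assoc]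
    rw [← h1] at hJ
    obtain ⟨r, hr⟩ := exists_eq_mul_right_of_mem hp heJ hJ
    rw [h1] at hr
    calc e * t * f * (f * s * e) = e * t * f * (f * s * e) * e := by
          simp only [mul_assoc]; rw [he]
      _ = e * t * f * (f * s * e) * (e * t * f * (f * s * e) * r) := by rw [← hr]
      _ = e := by rw [← mul_assoc, hidem, ← hr]
  exact ⟨MaximalSubgroup.congr hab hba (by rw [← mul_assoc, ← mul_assoc, hf])
    (by rw [mul_assoc, hf])⟩

theorem val_mem_jClass {he : IsIdempotentElem e} (heJ : e ∈ φ.jClass) (x : MaximalSubgroup he) :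
    x.1 ∈ φ.jClass := by
  refine jClass_of_mul_left (y := (x⁻¹).1) ?_ fun h => ?_
  · rwa [← MaximalSubgroup.val_mul, mul_inv_cancel, MaximalSubgroup.val_one]
  · rw [← x.mul_left] at h
    exact notMem_range_of_mem_jClass heJ (mem_range_of_mul_mem_range h).1

/-- The elements of `J(φ)` that are fixed by multiplication by an idempotent of `J(φ)` form its
maximal subgroup. -/
theorem exists_maximalSubgroup_val (hp : φ.WeaklyPrimitive) (he : IsIdempotentElem e)
    (heJ : e ∈ φ.jClass) {x : FreeProfiniteSemigroup A} (hx : x ∈ φ.jClass) (hex : e * x = x)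
    (hxe : x * e = x) : ∃ y : MaximalSubgroup he, y.1 = x := by
  obtain ⟨t, ht⟩ := exists_eq_mul_right_of_mem hp heJ (by rwa [hex])
  obtain ⟨s, hs⟩ := exists_eq_mul_left_of_mem hp heJ (by rwa [hxe])
  rw [hex] at ht
  rw [hxe] at hs
  have h1 : x * (e * t * e) = e := by rw [← mul_assoc, ← mul_assoc, hxe, ← ht, he]
  have h2 : e * s * e * x = e := by rw [mul_assoc, mul_assoc, hex, ← hs, he]
  have h3 : e * s * e = e * t * e := by
    calc e * s * e = e * s * e * (x * (e * t * e)) := by rw [h1, mul_assoc (e * s), he]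
      _ = e * (e * t * e) := by rw [← mul_assoc, h2]
      _ = e * t * e := by rw [← mul_assoc, ← mul_assoc, he]
  exact ⟨⟨x, ⟨hex, hxe⟩, e * t * e, ⟨by rw [← mul_assoc, ← mul_assoc, he], by rw [mul_assoc, he]⟩,
    h1, by rw [← h3, h2]⟩, rfl⟩

end Substitution

/-! ### The free profinite group and its finite quotients -/

namespace FreeProfiniteGroup

open CategoryTheory
variable {A : Type*}

/-- The canonical homomorphism from the free group to the free profinite group. -/
noncomputable def eta : FreeGroup A →* FreeProfiniteGroup A :=
  (ProfiniteGrp.ProfiniteCompletion.eta (GrpCat.of (FreeGroup A))).hom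

theorem denseRange_eta : DenseRange (eta (A := A)) :=
  ProfiniteGrp.ProfiniteCompletion.denseRange (GrpCat.of (FreeGroup A))

theorem eta_of (a : A) : eta (FreeGroup.of a) = of a := rfl

theorem exists_extension.{u} {A : Type u} (P : ProfiniteGrp.{u}) (f : FreeGroup A →* P) :
    ∃ Θ : FreeProfiniteGroup A →ₜ* P, ∀ w, Θ (eta w) = f w := by
  let f' : GrpCat.of (FreeGroup A) ⟶ GrpCat.of P := GrpCat.ofHom f
  refine ⟨(ProfiniteGrp.ProfiniteCompletion.lift f').hom, fun w => ?_⟩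
  exact ConcreteCategory.congr_hom (ProfiniteGrp.ProfiniteCompletion.lift_eta f') w

theorem extend_eta (φ : Substitution A) (w : FreeGroup A) :
    extend φ (eta w) = eta (groupHom φ w) :=
  ConcreteCategory.congr_hom (ProfiniteGrp.ProfiniteCompletion.lift_eta
    (GrpCat.ofHom (groupHom φ) ≫ ProfiniteGrp.ProfiniteCompletion.eta _)) w

theorem hom_ext {G : Type*} [Group G] [TopologicalSpace G] [T2Space G]
    {f g : FreeProfiniteGroup A →ₜ* G} (h : ∀ a, f (of a) = g (of a)) : f = g := by
  refine DFunLike.coe_injective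
    (denseRange_eta.equalizer f.continuous_toFun g.continuous_toFun (funext fun w => ?_))
  exact DFunLike.congr_fun (FreeGroup.ext_hom (f.toMonoidHom.comp eta) (g.toMonoidHom.comp eta) h) w

end FreeProfiniteGroup

namespace FreeProfiniteSemigroup

variable {A : Type*}

/-- Homomorphisms from `A⁺` to finite semigroups extend continuously to the free profinite
semigroup. -/
theorem exists_extension {Q : Type*} [Semigroup Q] [Finite Q] [TopologicalSpace Q]
    (f : FreeSemigroup A →ₙ* Q) :
    ∃ κ : FreeProfiniteSemigroup A →ₙ* Q, Continuous κ ∧ ∀ w, κ (ofWord w) = f w := by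
  obtain ⟨c, hc⟩ : ∃ c : FiniteCon A, ∀ u v, c.1 u v → f u = f v := ⟨⟨{
    r := fun u v => f u = f v
    iseqv := ⟨fun _ => rfl, fun h => h.symm, fun h h' => h.trans h'⟩
    mul' := fun h h' => by rw [map_mul, map_mul, h, h'] },
    Con.finite_quotient_of_map _ f fun _ _ h => h⟩, fun _ _ h => h⟩
  let κ : c.1.Quotient → Q := Quotient.lift f hc
  refine ⟨⟨fun x => κ (x.1 c), fun x y => ?_⟩,
    (continuous_of_discreteTopology (f := κ)).comp (continuous_coord c), fun w => rfl⟩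
  obtain ⟨u, hu⟩ := exists_coord_eq x c
  obtain ⟨v, hv⟩ := exists_coord_eq y c
  change κ (x.1 c * y.1 c) = κ (x.1 c) * κ (y.1 c)
  rw [hu, hv]
  exact map_mul f u v

end FreeProfiniteSemigroup

/-- Take an open normal V so small that xV misses N, and let U = NV. -/
theorem ProfiniteGrp.exists_openNormalSubgroup_ge {G : ProfiniteGrp} {N : Subgroup G} [N.Normal]
    (hN : IsClosed (N : Set G)) {x : G} (hx : x ∉ N) :
    ∃ U : OpenNormalSubgroup G, N ≤ U.toSubgroup ∧ x ∉ U.toSubgroup := by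
  have hopen : IsOpen {y : G | x * y ∉ N} :=
    (hN.preimage (continuous_const_mul x)).isOpen_compl
  obtain ⟨V, hV⟩ := ProfiniteGrp.exist_openNormalSubgroup_sub_open_nhds_of_one hopen
    (by simpa using hx)
  have : (N ⊔ V.toSubgroup).Normal := Subgroup.sup_normal _ _
  refine ⟨⟨⟨N ⊔ V.toSubgroup, Subgroup.isOpen_mono le_sup_right V.isOpen'⟩, this⟩,
    le_sup_left, fun h => ?_⟩
  obtain ⟨n, hn, v, hv, rfl⟩ := Subgroup.mem_sup_of_normal_left.1 (show x ∈ N ⊔ V.toSubgroup from h)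
  exact hV (V.toSubgroup.inv_mem hv) (by simpa using hn)

/-- The first isomorphism theorem for compact groups. -/
theorem exists_quotient_continuousMulEquiv {G H : Type*} [Group G] [TopologicalSpace G]
    [IsTopologicalGroup G] [CompactSpace G] [Group H] [TopologicalSpace H] [T2Space H]
    (f : G →ₜ* H) (hf : Function.Surjective f) {N : Subgroup G} [N.Normal]
    (hN : ∀ x, x ∈ N ↔ f x = 1) :
    ∃ Θ : G ⧸ N ≃ₜ* H, ∀ x : G, Θ (QuotientGroup.mk x) = f x := by
  let F : G ⧸ N →* H := QuotientGroup.lift N f.toMonoidHom fun x hx => (hN x).1 hx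
  have hF : ∀ x : G, F (QuotientGroup.mk x) = f x := fun _ => rfl
  have hcont : Continuous F := continuous_quot_lift _ f.continuous_toFun
  have hbij : Function.Bijective F := by
    refine ⟨(injective_iff_map_eq_one F).2 fun x => ?_, fun y => ?_⟩
    · induction x using QuotientGroup.induction_on with | _ x
      exact fun h => (QuotientGroup.eq_one_iff x).2 ((hN x).2 h)
    · obtain ⟨x, rfl⟩ := hf y
      exact ⟨x, rfl⟩
  let E : G ⧸ N ≃* H := MulEquiv.ofBijective F hbij
  have hE : Continuous E := hcont
  exact ⟨{ E with
    continuous_toFun := hE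
    continuous_invFun := (hE.homeoOfEquivCompactToT2 (f := E.toEquiv)).continuous_invFun }, hF⟩

namespace FreeProfiniteGroup

variable {A : Type*}

theorem groupHom_lift (φ : Substitution A) (w : FreeSemigroup A) :
    groupHom φ (FreeSemigroup.lift FreeGroup.of w) = FreeSemigroup.lift FreeGroup.of (φ w) := by
  induction w using FreeSemigroup.recOnMul with
  | ih1 a => rw [FreeSemigroup.lift_of, groupHom, FreeGroup.lift_apply_of]
  | ih2 a w ha hw => rw [map_mul, map_mul, map_mul, map_mul, ha, hw]

/-- The canonical homomorphism from `A⁺` to the free profinite group. -/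
noncomputable def ofWord (w : FreeSemigroup A) : FreeProfiniteGroup A :=
  eta (FreeSemigroup.lift FreeGroup.of w)

theorem ofWord_of (a : A) : ofWord (FreeSemigroup.of a) = of a := rfl

theorem ofWord_mul (u v : FreeSemigroup A) : ofWord (u * v) = ofWord u * ofWord v := by
  rw [ofWord, map_mul, map_mul]
  rfl

theorem iterate_extend_ofWord (φ : Substitution A) (k : ℕ) (w : FreeSemigroup A) :
    (extend φ)^[k] (ofWord w) = ofWord (φ^[k] w) :=
  ((Function.Semiconj.iterate_right (f := ofWord) (ga := φ) (gb := extend φ)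
    (fun w => by rw [ofWord, ofWord, extend_eta, groupHom_lift]) k) w).symm

end FreeProfiniteGroup

open FreeProfiniteSemigroup

/-! ### Kernel and image of the map onto the maximal subgroup -/

namespace Substitution

variable {A : Type*} [Finite A] {φ : Substitution A} {e : FreeProfiniteSemigroup A}
  {he : IsIdempotentElem e}

theorem apply_ofWord_eq_omegaPow {Θ : FreeProfiniteGroup A →ₜ* MaximalSubgroup he}
    (hΘ : ∀ a, (Θ (FreeProfiniteGroup.of a)).1 = gen φ a) (w : FreeSemigroup A) :
    (Θ (FreeProfiniteGroup.ofWord w)).1 = omegaPow (FreeProfiniteSemigroup.extend φ) (ofWord w) := by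
  induction w using FreeSemigroup.recOnMul with
  | ih1 a => exact hΘ a
  | ih2 a w ha hw =>
    rw [FreeProfiniteGroup.ofWord_mul, map_mul, MaximalSubgroup.val_mul, ha, hw, ofWord_mul,
      omegaPow_mul]

/-- The relators of the presentation are satisfied by the elements `φ^ω(a)`. -/
theorem apply_relator {Θ : FreeProfiniteGroup A →ₜ* MaximalSubgroup he}
    (hΘ : ∀ a, (Θ (FreeProfiniteGroup.of a)).1 = gen φ a) (a : A) :
    Θ (omegaPow (FreeProfiniteGroup.extend φ) (FreeProfiniteGroup.of a)) =
      Θ (FreeProfiniteGroup.of a) := by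
  refine MaximalSubgroup.ext (tendsto_nhds_unique
    (((MaximalSubgroup.continuous_val.comp Θ.continuous_toFun).tendsto _).comp
      (FreeProfiniteGroup.tendsto_omegaPow φ (FreeProfiniteGroup.of a))) ?_)
  -- Θ sends the n!-th iterate of a in the free profinite group to the n!-th iterate of `φ^ω(a)`,
  -- and these converge to `φ^ω(φ^ω(a))` = `φ^ω(a)`.
  have h := tendsto_omegaPow φ (gen φ a)
  rw [omegaPow_gen, ← hΘ] at h
  refine h.congr fun n => ?_
  have h1 := apply_ofWord_eq_omegaPow hΘ (φ^[n.factorial] (FreeSemigroup.of a))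
  rw [← FreeProfiniteGroup.iterate_extend_ofWord, ← FreeProfiniteSemigroup.iterate_extend_ofWord,
    ← iterate_extend_omegaPow] at h1
  exact (congrArg _ (hΘ a)).trans h1.symm

/-- A continuous homomorphism to a finite group that satisfies the relators factors through the
elements `φ^ω(a)`. -/
theorem apply_eq_one_of_relators {Θ : FreeProfiniteGroup A →ₜ* MaximalSubgroup he}
    (hΘ : ∀ a, (Θ (FreeProfiniteGroup.of a)).1 = gen φ a) {Q : Type*} [Group Q] [Finite Q]
    [TopologicalSpace Q] [T2Space Q] (q : FreeProfiniteGroup A →ₜ* Q)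
    (hq : ∀ a, q (omegaPow (FreeProfiniteGroup.extend φ) (FreeProfiniteGroup.of a)) =
      q (FreeProfiniteGroup.of a)) {x : FreeProfiniteGroup A} (hx : Θ x = 1) : q x = 1 := by
  let f : FreeSemigroup A →ₙ* Q := ⟨fun w => q (FreeProfiniteGroup.ofWord w), fun u v => by
    rw [FreeProfiniteGroup.ofWord_mul, map_mul]⟩
  obtain ⟨κ, hκ, hκw⟩ := FreeProfiniteSemigroup.exists_extension f
  let κ' : MaximalSubgroup he →ₜ* Q :=
    ⟨MaximalSubgroup.toGroup κ, hκ.comp MaximalSubgroup.continuous_val⟩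
  -- On a letter, q(a) = q(`φ_G^ω(a)`) is the limit of the values of q on iterates of a. These are
  -- also values of κ on words that tend to `φ^ω(a)` = Θ(a).
  have h : q = κ'.comp Θ := by
    refine FreeProfiniteGroup.hom_ext fun a => ?_
    change q _ = κ (Θ _).1
    rw [hΘ, ← hq]
    refine tendsto_nhds_unique ((q.continuous_toFun.tendsto _).comp
      (FreeProfiniteGroup.tendsto_omegaPow φ (FreeProfiniteGroup.of a))) ?_
    refine ((hκ.tendsto _).comp (tendsto_omegaPow φ _)).congr fun n => ?_
    rw [Function.comp_apply, FreeProfiniteSemigroup.iterate_extend_ofWord, hκw]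
    change q _ = q _
    rw [← FreeProfiniteGroup.iterate_extend_ofWord, FreeProfiniteGroup.ofWord_of]
  rw [h]
  change κ' (Θ x) = 1
  rw [hx, map_one]

/-- An element outside the closed normal subgroup survives in a finite quotient satisfying the
relators, and such a quotient factors through Θ by `apply_eq_one_of_relators`. -/
theorem mem_topologicalClosure_relators_iff {Θ : FreeProfiniteGroup A →ₜ* MaximalSubgroup he}
    (hΘ : ∀ a, (Θ (FreeProfiniteGroup.of a)).1 = gen φ a) (x : FreeProfiniteGroup A) :
    x ∈ (Subgroup.normalClosure φ.relators).topologicalClosure ↔ Θ x = 1 := by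
  constructor
  · intro hx
    have h1 : Subgroup.normalClosure φ.relators ≤ Θ.toMonoidHom.ker := by
      refine Subgroup.normalClosure_le_normal ?_
      rintro _ ⟨a, rfl⟩
      change Θ _ = 1
      rw [map_mul, map_inv, apply_relator hΘ, mul_inv_cancel]
    have h2 : IsClosed ((Θ.toMonoidHom.ker : Subgroup _) : Set (FreeProfiniteGroup A)) :=
      isClosed_singleton.preimage Θ.continuous_toFun
    exact Subgroup.topologicalClosure_minimal _ h1 h2 hx
  · intro hx
    by_contra hxN
    obtain ⟨U, hNU, hxU⟩ := ProfiniteGrp.exists_openNormalSubgroup_ge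
      (Subgroup.isClosed_topologicalClosure _) hxN
    have : DiscreteTopology (FreeProfiniteGroup A ⧸ U.toSubgroup) :=
      QuotientGroup.discreteTopology U.isOpen'
    have : Finite (FreeProfiniteGroup A ⧸ U.toSubgroup) := finite_of_compact_of_discrete
    let q : FreeProfiniteGroup A →ₜ* FreeProfiniteGroup A ⧸ U.toSubgroup :=
      ⟨QuotientGroup.mk' U.toSubgroup, continuous_quot_mk⟩
    refine hxU ((QuotientGroup.eq_one_iff x).1 (apply_eq_one_of_relators hΘ q (fun a => ?_) hx))
    have h1 := hNU (Subgroup.le_topologicalClosure _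
      (Subgroup.subset_normalClosure (show _ ∈ φ.relators from ⟨a, rfl⟩)))
    have h2 := (QuotientGroup.eq_one_iff _).2 h1
    change (QuotientGroup.mk' U.toSubgroup) _ = 1 at h2
    rw [map_mul, map_inv, mul_inv_eq_one] at h2
    exact h2

/-- The image of Θ is compact, hence closed, and it contains all `φ^ω(w)`. -/
theorem surjective_of_mem_closure {Θ : FreeProfiniteGroup A →ₜ* MaximalSubgroup he}
    (hΘ : ∀ a, (Θ (FreeProfiniteGroup.of a)).1 = gen φ a)
    (h : ∀ x : MaximalSubgroup he, x.1 ∈ closure (Set.range fun w : FreeSemigroup A =>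
      omegaPow (FreeProfiniteSemigroup.extend φ) (ofWord w))) : Function.Surjective Θ := by
  intro x
  have h1 : IsClosed (Set.range fun y => (Θ y).1) :=
    (isCompact_range (MaximalSubgroup.continuous_val.comp Θ.continuous_toFun)).isClosed
  obtain ⟨y, hy⟩ := closure_minimal (by
    rintro _ ⟨w, rfl⟩
    exact ⟨_, apply_ofWord_eq_omegaPow hΘ w⟩) h1 (h x)
  exact ⟨y, MaximalSubgroup.ext hy⟩

end Substitution

theorem theoremt {A : Type*} [Finite A] [Nonempty A] (φ : Substitution A)
    (hprim : φ.WeaklyPrimitive)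
    (hfirst : ∃ a : A, ∀ x : A, (φ (FreeSemigroup.of x)).head = a)
    (hlast : ∃ b : A, ∀ x : A, (φ (FreeSemigroup.of x)).last = b)
    (hdelay : φ.IsEncodingOfBoundedDelay φ.jFactors) :
    (∃ (e : FreeProfiniteSemigroup A) (he : IsIdempotentElem e), e ∈ φ.jClass ∧
      ∃ Θ : PresentedProfiniteGroup φ.relators ≃ₜ* MaximalSubgroup he,
        ∀ a : A, (Θ (QuotientGroup.mk (FreeProfiniteGroup.of a))).1 =
          omegaPow (FreeProfiniteSemigroup.extend φ)
            (FreeProfiniteSemigroup.ofWord (FreeSemigroup.of a))) ∧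
    ∀ (e : FreeProfiniteSemigroup A) (he : IsIdempotentElem e), e ∈ φ.jClass →
      Nonempty (PresentedProfiniteGroup φ.relators ≃ₜ* MaximalSubgroup he) := by
  obtain ⟨a, ha⟩ := hfirst
  obtain ⟨b, hb⟩ := hlast
  obtain ⟨e, heJ, hee', hφe, hmem⟩ := Substitution.exists_idempotent hprim ha hb
  have hee : IsIdempotentElem e := hee'
  have hgen := Substitution.gen_mem_hClass hprim ha hb
  -- Delay is assumed for the finite factors of J(φ); these include the whole language since J(φ),
  -- which contains e, is nonempty.
  obtain ⟨N, hN⟩ := hdelay.exists_delay (Substitution.language_subset_jFactors hprim ⟨e, heJ⟩)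
  have hpre := Substitution.exists_preimage_of_mem_lang hprim ((Substitution.mem_language_iff φ).1
    (Substitution.mem_language_of_mul_right (Substitution.pair_mem_lang hprim ha hb)))
  choose g hg using fun c => Substitution.exists_maximalSubgroup_val hprim hee heJ (hgen c).1
    (hmem _ (hgen c)).1 (hmem _ (hgen c)).2
  obtain ⟨Θ, hΘ⟩ := FreeProfiniteGroup.exists_extension
    (ProfiniteGrp.of (MaximalSubgroup hee)) (FreeGroup.lift g)
  have hΘ' : ∀ c, (Θ (FreeProfiniteGroup.of c)).1 = FreeProfiniteSemigroup.gen φ c := by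
    intro c
    rw [← FreeProfiniteGroup.eta_of, hΘ, FreeGroup.lift_apply_of, hg]
  obtain ⟨E, hE⟩ := exists_quotient_continuousMulEquiv Θ
    (Substitution.surjective_of_mem_closure hΘ' fun x =>
      FreeProfiniteSemigroup.mem_closure_omegaPow φ
        (Substitution.exists_iterate_extend_eq hprim hdelay.1 hN hpre heJ hee hφe
          (Substitution.val_mem_jClass heJ x) x.mul_left x.mul_right))
    (Substitution.mem_topologicalClosure_relators_iff hΘ')
  refine ⟨⟨e, hee, heJ, E, fun c => by rw [hE]; exact hΘ' c⟩, fun f hf hfJ => ?_⟩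
  obtain ⟨E'⟩ := Substitution.nonempty_maximalSubgroup_equiv hprim hee hf heJ hfJ
  exact ⟨E.trans E'⟩
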